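/- Setting. Let $B,c,\lambda,\mu,\nu>0$. An agent has until a deadline $T\in(0,\infty)$ to solve a problem. At each remaining time $\tau\in[0,T]$ she splits one unit of effort, which costs $c$ per unit of time, between a doing arm (share $a_\tau\in[0,1]$) and a thinking arm (share $1-a_\tau$). The doing arm yields a solution worth $B$ at rate $\lambda a_\tau$ if it is good and never otherwise; her prior that it is good is $\bar p\in(0,1)$. The thinking arm yields progress at rate $\mu(1-a_\tau)$; progress with time $\tau$ remaining gives access to a new arm of known rate $\nu$, prize $B$ and flow cost $c$, hence is worth $$V(\tau)=\int_0^\tau e^{-\nu s}(\nu B-c)\,ds=(1-e^{-\nu\tau})\Big(B-\frac c\nu\Big),\qquad V(\infty)=B-\frac c\nu .$$ Assume $V(\infty)>c/\mu$ and $\nu\ge\lambda\bar p$. With $A_\tau=\int_\tau^T a_s\,ds$, her belief absent any arrival is $p_\tau=\frac{\bar p e^{-\lambda A_\tau}}{\bar p e^{-\lambda A_\tau}+1-\bar p}$, and an optimal policy is a measurable $a:[0,T]\to[0,1]$ that maximizes $$\int_0^T e^{-\mu(T-\tau-A_\tau)}\,(1-\bar p+\bar p e^{-\lambda A_\tau})\,\big(\mu(1-a_\tau)V(\tau)+\lambda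 a_\tau p_\tau B-c\big)\,d\tau .$$ Let $U(\tau)=(1-e^{-\lambda\tau})(B-c/\lambda)$ and $$\hat q(\tau)=\frac{\mu(V(\tau)+c\tau)}{\mu(B+c\tau)+(\lambda-\mu)(B-U(\tau))},\qquad q(\tau)=\min\{1,\hat q(\tau)\}\quad(\tau\ge0),\qquad \hat p=\frac{c/\lambda}{B-V(\infty)+c/\mu}=\frac{\mu\nu}{\lambda(\mu+\nu)} .$$ Assume that $V(\infty)\le B+c/\mu$ and that, if $\mu>\lambda$, the function $\tau\mapsto\frac{\mu V''(\tau)}{(\mu-\lambda)U''(\tau)}-\hat q(\tau)$ is monotonic on $[0,\infty)$. Statement. Fix $B,c,\lambda,\mu,\nu$ as above. All of the following holds for every deadline $T>0$; $\tilde p$ and $q^{-1}(\hat p)$ depend neither on $T$ nor on $\bar p$. Statements about policies are up to null sets of times. (1) If $\hat p<1$, there are $\tilde p$ and $\tilde\tau\ge0$ with $q(\tilde\tau)=\tilde p$ (that is, $\tilde\tau\in q^{-1}(\{\tilde p\})$) and $$\tilde p=\frac{V'(\tilde\tau)+c}{\lambda\,(B+c/\mu-V(\tilde\tau))},$$ such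 that whenever $\bar p>\tilde p$, every optimal policy begins with a doing period of positive length. (2) If $\bar p<\hat p$, then under every optimal policy the agent switches arms at most once, and only from thinking to doing. (3) If $\hat p<1$, there is exactly one time $q^{-1}(\hat p)\ge0$ at which $q$ equals $\hat p$. If $\bar p\ge\hat p$ (which forces $\hat p<1$), then under every optimal policy the belief satisfies, for all $\tau\in[0,T]$, $$p_\tau\ \ge\ \check p:=\frac{\hat p e^{-\lambda q^{-1}(\hat p)}}{\hat p e^{-\lambda q^{-1}(\hat p)}+1-\hat p} .$$ Moreover, $\check p\ge\frac{\bar p e^{-\lambda T}}{\bar p e^{-\lambda T}+1-\bar p}$ (the belief after doing for the whole time $T$) if and only if $T\ge q^{-1}(\hat p)+\frac1\lambda\ln\frac{\bar p(1-\hat p)}{\hat p(1-\bar p)}$. -/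

import Mathlib

open Set Filter Topology MeasureTheory

noncomputable section

/-- Parameters of the thinking-or-doing problem in which progress on the thinking arm delivers a
new Poisson arm of known arrival rate `nu`.
`B`: payoff of a solution, `c`: flow cost of effort (on every arm), `lam`: arrival rate of a good
doing arm, `mu`: arrival rate of progress on the thinking arm.
The last field is the standing assumption `V(∞) > c / mu`. -/
structure DoThink where
  B : ℝ
  c : ℝ
  lam : ℝ
  mu : ℝ
  nu : ℝ
  B_pos : 0 < B
  c_pos : 0 < c
  lam_pos : 0 < lam
  mu_pos : 0 < mu
  nu_pos : 0 < nu
  progress_valuable : c / mu < B - c / nu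

namespace DoThink

variable (M : DoThink)

/-- Value of progress with time `τ` remaining: the expected payoff of pulling the new arm (arrival
rate `nu`, prize `B`, flow cost `c`) until it succeeds or the deadline is reached. -/
def V (τ : ℝ) : ℝ := ∫ s in (0 : ℝ)..τ, Real.exp (-(M.nu * s)) * (M.nu * M.B - M.c)

/-- `V(∞)`, the limit of `V` (see `tendsto_V`). -/
def Vinf : ℝ := M.B - M.c / M.nu

theorem V_eq (τ : ℝ) : M.V τ = (1 - Real.exp (-(M.nu * τ))) * (M.B - M.c / M.nu) := by
  have hn := M.nu_pos.ne'
  have hd : ∀ x ∈ uIcc (0 : ℝ) τ,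
      HasDerivAt (fun s => -Real.exp (-(M.nu * s)) * (M.B - M.c / M.nu))
        (Real.exp (-(M.nu * x)) * (M.nu * M.B - M.c)) x := by
    intro x _
    have h1 : HasDerivAt (fun s : ℝ => -(M.nu * s)) (-(M.nu * 1)) x :=
      ((hasDerivAt_id x).const_mul M.nu).neg
    refine ((h1.exp.neg).mul_const (M.B - M.c / M.nu)).congr_deriv ?_
    field_simp
  rw [V, intervalIntegral.integral_eq_sub_of_hasDerivAt hd
    (Continuous.intervalIntegrable (by fun_prop) _ _)]
  simp
  ring

theorem tendsto_V : Tendsto M.V atTop (𝓝 M.Vinf) := by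
  have h : M.V = fun τ => (1 - Real.exp (-(M.nu * τ))) * (M.B - M.c / M.nu) :=
    funext M.V_eq
  have h1 : Tendsto (fun τ : ℝ => Real.exp (-(M.nu * τ))) atTop (𝓝 0) :=
    Real.tendsto_exp_neg_atTop_nhds_zero.comp (tendsto_id.const_mul_atTop M.nu_pos)
  rw [h, Vinf]
  simpa using (h1.const_sub 1).mul_const (M.B - M.c / M.nu)

/-- Value of pulling for time `τ` an arm known to have arrival rate `lam`. -/
def U (τ : ℝ) : ℝ := (1 - Real.exp (-(M.lam * τ))) * (M.B - M.c / M.lam)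

/-- The belief at which the agent with time `τ` remaining is indifferent between doing until the
deadline and thinking for an instant before doing until the deadline. -/
def qHat (τ : ℝ) : ℝ :=
  M.mu * (M.V τ + M.c * τ) /
    (M.mu * (M.B + M.c * τ) + (M.lam - M.mu) * (M.B - M.U τ))

/-- `q = min {1, q̂}`. -/
def q (τ : ℝ) : ℝ := min 1 (M.qHat τ)

/-- The set `q⁻¹({p})` of remaining times `τ ≥ 0` with `q τ = p`. -/
def qPreimage (p : ℝ) : Set ℝ := {τ | 0 ≤ τ ∧ M.q τ = p}

/-- The regularity assumption: (i) `V(∞) ≤ B + c / mu`, and (ii) if `mu > lam`, then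
`mu V'' / ((mu - lam) U'') - q̂` is monotonic in the remaining time. -/
def Regular : Prop :=
  M.Vinf ≤ M.B + M.c / M.mu ∧
  (M.lam < M.mu →
    MonotoneOn (fun τ => M.mu * deriv (deriv M.V) τ /
        ((M.mu - M.lam) * deriv (deriv M.U) τ) - M.qHat τ) (Ici 0) ∨
    AntitoneOn (fun τ => M.mu * deriv (deriv M.V) τ /
        ((M.mu - M.lam) * deriv (deriv M.U) τ) - M.qHat τ) (Ici 0))

/-- The switching belief `p̂` of the problem without a deadline. -/
def pHat : ℝ := (M.c / M.lam) / (M.B - M.Vinf + M.c / M.mu)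

theorem pHat_eq : M.pHat = M.mu * M.nu / (M.lam * (M.mu + M.nu)) := by
  have h1 := M.c_pos.ne'
  have h2 := M.lam_pos.ne'
  have h3 := M.mu_pos.ne'
  have h4 := M.nu_pos.ne'
  have h5 : M.mu + M.nu ≠ 0 := (add_pos M.mu_pos M.nu_pos).ne'
  have h6 : M.B - M.Vinf + M.c / M.mu = M.c * (M.mu + M.nu) / (M.mu * M.nu) := by
    rw [Vinf]
    field_simp
    ring
  rw [pHat, h6]
  field_simp

/-- Right-hand side of the fixed-point equation for the threshold `p̃`. -/
def thresholdRHS (τ : ℝ) : ℝ :=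
  (deriv M.V τ + M.c) / (M.lam * (M.B + M.c / M.mu - M.V τ))

/-- Bayes' rule: the belief that the doing arm is good after effort `x` without success on it,
starting from the belief `p`. -/
def posterior (p x : ℝ) : ℝ :=
  p * Real.exp (-(M.lam * x)) / (p * Real.exp (-(M.lam * x)) + (1 - p))

/-- Admissible effort paths with deadline `T`, as functions of the remaining time: with time `τ`
remaining the effort `a τ` goes into doing and `1 - a τ` into thinking. -/
def Admissible (T : ℝ) (a : ℝ → ℝ) : Prop :=
  Measurable a ∧ ∀ τ ∈ Icc 0 T, a τ ∈ Icc (0 : ℝ) 1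

/-- Past effort on the doing arm when time `τ` remains. -/
def pastDoing (T : ℝ) (a : ℝ → ℝ) (τ : ℝ) : ℝ := ∫ s in τ..T, a s

/-- The agent's belief with time `τ` remaining, absent any arrival. -/
def belief (pbar T : ℝ) (a : ℝ → ℝ) (τ : ℝ) : ℝ := M.posterior pbar (pastDoing T a τ)

/-- The agent's expected payoff from the effort path `a`: integral of the probability of no
progress so far, times the probability of no solution so far, times the expected flow payoff. -/
def payoff (pbar T : ℝ) (a : ℝ → ℝ) : ℝ :=
  ∫ τ in (0 : ℝ)..T,
    Real.exp (-(M.mu * (T - τ - pastDoing T a τ))) *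
      (1 - pbar + pbar * Real.exp (-(M.lam * pastDoing T a τ))) *
      (M.mu * (1 - a τ) * M.V τ + M.lam * a τ * M.belief pbar T a τ * M.B - M.c)

/-- `a` is an optimal policy for the initial belief `pbar` and the deadline `T`. -/
def IsOptimal (pbar T : ℝ) (a : ℝ → ℝ) : Prop :=
  Admissible T a ∧ ∀ b, Admissible T b → M.payoff pbar T b ≤ M.payoff pbar T a

/-- The agent begins with a doing period: full effort on the doing arm (up to a null set of times)
during some initial period of positive length. -/
def BeginsWithDoing (T : ℝ) (a : ℝ → ℝ) : Prop :=
  ∃ ε, 0 < ε ∧ ε ≤ T ∧ ∀ᵐ τ, τ ∈ Icc (T - ε) T → a τ = 1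

/-- The agent switches arms at most once and only from thinking to doing: for some `s` in
`[0, T]`, up to a null set of times, she thinks while more than `s` time remains and does
afterwards. -/
def AtMostThinkThenDo (T : ℝ) (a : ℝ → ℝ) : Prop :=
  ∃ s ∈ Icc (0 : ℝ) T,
    (∀ᵐ τ, τ ∈ Ioc s T → a τ = 0) ∧ (∀ᵐ τ, τ ∈ Ico 0 s → a τ = 1)

end DoThink

end

noncomputable section

namespace DoThink

variable (M : DoThink)

/-! A policy is a path in the plane of doing effort `x` and thinking effort `y`, with `T - x - y`
time remaining. Reordering the efforts, as in Green's theorem, writes its payoff as that of a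
reference path with the same endpoint plus a line integral of a difference of `thinkGain` values
(`integral_flow`). The derivative of `thinkGain` in `x` has the sign of the belief minus
`thresholdRHS` (`hasDerivAt_thinkGain`).

The curve `thresholdRHS` strictly decreases in remaining time, towards `pHat`, while the belief
falls as doing goes on. Hence a belief at or below the curve stays below it, and an optimal policy
thinks first and does afterwards (`IsOptimal.exists_switchesAt`); since the whole curve exceeds
`pHat`, this is (2). If instead the belief stays above the curve until `s` remains, all doing before
`s` comes first (`IsOptimal.beginsWithDoing`).

Among think-then-do policies the first-order condition in the switching time `s` compares the belief
with `qHat s` (`hasDerivAt_thinkThenDoPayoff`), and `qHat` crosses levels below the curve only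
upwards (`qHat_gt_of_le`). For (1), `ptilde` is the height at which `q` meets the curve: a belief
above it that starts with thinking violates the first-order condition or the ordering above the
curve. For (3), from the last moment at which the belief is `pHat` the agent only does; the
first-order condition bounds the time then left by `q⁻¹(pHat)`, hence the final belief. -/

/-! ### The value of progress and the threshold curve. -/

theorem W_pos : 0 < M.B - M.c / M.nu :=
  (div_pos M.c_pos M.mu_pos).trans M.progress_valuable

theorem V_zero : M.V 0 = 0 := by simp [V_eq]

theorem hasDerivAt_V (τ : ℝ) :
    HasDerivAt M.V (M.nu * (M.B - M.c / M.nu - M.V τ)) τ := by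
  have h : M.V = fun τ => (1 - Real.exp (-(M.nu * τ))) * (M.B - M.c / M.nu) := funext M.V_eq
  rw [M.V_eq τ, h]
  have h1 : HasDerivAt (fun s : ℝ => -(M.nu * s)) (-(M.nu * 1)) τ :=
    ((hasDerivAt_id τ).const_mul M.nu).neg
  refine ((h1.exp.const_sub 1).mul_const (M.B - M.c / M.nu)).congr_deriv ?_
  ring

theorem V_lt (τ : ℝ) : M.V τ < M.B - M.c / M.nu := by
  rw [M.V_eq]
  nlinarith [mul_pos (Real.exp_pos (-(M.nu * τ))) M.W_pos]

theorem prize_gap_pos (τ : ℝ) : 0 < M.B + M.c / M.mu - M.V τ := by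
  have := M.V_lt τ
  have := div_pos M.c_pos M.mu_pos
  have := div_pos M.c_pos M.nu_pos
  linarith

theorem strictMono_V : StrictMono M.V := by
  refine strictMono_of_deriv_pos fun x => ?_
  rw [(M.hasDerivAt_V x).deriv]
  exact mul_pos M.nu_pos (sub_pos.2 (M.V_lt x))

theorem continuous_V : Continuous M.V :=
  continuous_iff_continuousAt.2 fun x => (M.hasDerivAt_V x).continuousAt

theorem V_nonneg {τ : ℝ} (h : 0 ≤ τ) : 0 ≤ M.V τ := by
  rw [← M.V_zero]; exact M.strictMono_V.monotone h

/-- Since `V' + c = ν (B - V)`, time enters only through `V τ` in one denominator; monotonicity,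
continuity and the limit can then be read off. -/
theorem thresholdRHS_eq (τ : ℝ) :
    M.thresholdRHS τ = M.nu / M.lam * (1 - M.c / M.mu / (M.B + M.c / M.mu - M.V τ)) := by
  have h := (M.prize_gap_pos τ).ne'
  have h1 : M.nu * (M.B - M.c / M.nu - M.V τ) + M.c = M.nu * (M.B - M.V τ) := by
    have := M.nu_pos.ne'
    field_simp
    ring
  rw [thresholdRHS, (M.hasDerivAt_V τ).deriv, h1, one_sub_div h, div_mul_div_comm]
  congr 2
  ring

theorem strictAnti_thresholdRHS : StrictAnti M.thresholdRHS := by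
  intro s t hst
  rw [thresholdRHS_eq, thresholdRHS_eq]
  have h1 := M.prize_gap_pos t
  have h2 := M.strictMono_V hst
  have h3 := div_pos M.c_pos M.mu_pos
  refine mul_lt_mul_of_pos_left ?_ (div_pos M.nu_pos M.lam_pos)
  refine sub_lt_sub_left (div_lt_div_of_pos_left h3 h1 (by linarith)) _

theorem continuous_thresholdRHS : Continuous M.thresholdRHS := by
  rw [show M.thresholdRHS = _ from funext M.thresholdRHS_eq]
  have := M.continuous_V
  have h := fun τ => (M.prize_gap_pos τ).ne'
  fun_prop (disch := exact h _)

/-- After cross-multiplication the gap is `λ ν (V(∞) - V τ) c / μ`, which is positive. -/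
theorem pHat_lt_thresholdRHS (τ : ℝ) : M.pHat < M.thresholdRHS τ := by
  have h1 := M.prize_gap_pos τ
  have h2 := M.V_lt τ
  have h3 := div_pos M.c_pos M.mu_pos
  have h4 := div_pos M.c_pos M.nu_pos
  have hn := M.nu_pos.ne'
  have hl := M.lam_pos
  rw [pHat, thresholdRHS, (M.hasDerivAt_V τ).deriv, Vinf, div_div,
    div_lt_div_iff₀ (mul_pos hl (by linarith)) (mul_pos hl h1)]
  have h5 : M.c = M.nu * (M.c / M.nu) := by field_simp
  have h6 := mul_pos (mul_pos (mul_pos hl M.nu_pos) (sub_pos.2 h2)) h3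
  generalize M.c / M.mu = m at *
  generalize M.c / M.nu = n at *
  rw [h5]
  linarith

theorem pHat_pos : 0 < M.pHat := by
  rw [pHat_eq]
  have := M.mu_pos; have := M.nu_pos; have := M.lam_pos
  positivity

theorem thresholdRHS_pos (τ : ℝ) : 0 < M.thresholdRHS τ :=
  M.pHat_pos.trans (M.pHat_lt_thresholdRHS τ)

theorem tendsto_thresholdRHS : Tendsto M.thresholdRHS atTop (𝓝 M.pHat) := by
  have h1 : 0 < M.B + M.c / M.mu - M.Vinf := by
    have := div_pos M.c_pos M.mu_pos
    have := div_pos M.c_pos M.nu_pos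
    rw [Vinf]; linarith
  have h2 : Tendsto (fun τ => M.nu / M.lam * (1 - M.c / M.mu / (M.B + M.c / M.mu - M.V τ))) atTop
      (𝓝 (M.nu / M.lam * (1 - M.c / M.mu / (M.B + M.c / M.mu - M.Vinf)))) :=
    ((tendsto_const_nhds.div (M.tendsto_V.const_sub _) h1.ne').const_sub _).const_mul _
  rw [← show M.thresholdRHS = _ from funext M.thresholdRHS_eq] at h2
  convert h2 using 2
  have hn := M.nu_pos.ne'
  have hl := M.lam_pos.ne'
  have hm := M.mu_pos.ne'
  rw [pHat]
  rw [show M.B - M.Vinf + M.c / M.mu = M.B + M.c / M.mu - M.Vinf by ring]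
  have h3 : M.c = M.nu * (M.B - M.Vinf) := by rw [Vinf]; field_simp; ring
  rw [one_sub_div h1.ne', div_eq_iff h1.ne', div_mul_eq_mul_div, div_mul_eq_mul_div, ← mul_div_assoc,
    div_mul_cancel₀ _ h1.ne']
  congr 1
  linarith

/-! ### The indifference belief `qHat`. -/

theorem U_zero : M.U 0 = 0 := by simp [U]

theorem hasDerivAt_U (τ : ℝ) : HasDerivAt M.U (M.lam * (M.B - M.U τ) - M.c) τ := by
  have hl := M.lam_pos.ne'
  have h1 : HasDerivAt (fun s : ℝ => -(M.lam * s)) (-(M.lam * 1)) τ :=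
    ((hasDerivAt_id τ).const_mul M.lam).neg
  refine ((h1.exp.const_sub 1).mul_const (M.B - M.c / M.lam)).congr_deriv ?_
  rw [U]; field_simp; ring

theorem continuous_U : Continuous M.U :=
  continuous_iff_continuousAt.2 fun x => (M.hasDerivAt_U x).continuousAt

/-- The numerator of `qHat`. -/
def qNum (τ : ℝ) : ℝ := M.mu * (M.V τ + M.c * τ)

/-- The denominator of `qHat`. -/
def qDen (τ : ℝ) : ℝ := M.mu * (M.B + M.c * τ) + (M.lam - M.mu) * (M.B - M.U τ)

theorem qHat_eq (τ : ℝ) : M.qHat τ = M.qNum τ / M.qDen τ := rfl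

theorem hasDerivAt_qNum (τ : ℝ) :
    HasDerivAt M.qNum (M.mu * (M.nu * (M.B - M.c / M.nu - M.V τ) + M.c)) τ := by
  refine (((M.hasDerivAt_V τ).add ((hasDerivAt_id τ).const_mul M.c)).const_mul M.mu).congr_deriv ?_
  ring

theorem hasDerivAt_qDen (τ : ℝ) :
    HasDerivAt M.qDen
      (M.mu * M.c - (M.lam - M.mu) * (M.lam * (M.B - M.U τ) - M.c)) τ := by
  refine (((((hasDerivAt_id τ).const_mul M.c).const_add M.B).const_mul M.mu).add
    (((M.hasDerivAt_U τ).const_sub M.B).const_mul (M.lam - M.mu))).congr_deriv ?_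
  ring

theorem B_sub_U (τ : ℝ) :
    M.B - M.U τ = Real.exp (-(M.lam * τ)) * M.B + (1 - Real.exp (-(M.lam * τ))) * (M.c / M.lam) := by
  rw [U]; ring

theorem exp_neg_lam_le {τ : ℝ} (h : 0 ≤ τ) : Real.exp (-(M.lam * τ)) ≤ 1 :=
  Real.exp_le_one_iff.2 (neg_nonpos.2 (mul_nonneg M.lam_pos.le h))

theorem B_sub_U_pos {τ : ℝ} (h : 0 ≤ τ) : 0 < M.B - M.U τ := by
  rw [B_sub_U]
  have h1 := M.exp_neg_lam_le h
  have h2 := mul_pos (Real.exp_pos (-(M.lam * τ))) M.B_pos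
  have h3 := mul_nonneg (sub_nonneg.2 h1) (div_pos M.c_pos M.lam_pos).le
  linarith

theorem B_sub_U_le {τ : ℝ} (h : 0 ≤ τ) : M.B - M.U τ ≤ M.B + M.c / M.lam := by
  rw [B_sub_U]
  have h1 := M.exp_neg_lam_le h
  have h0 := Real.exp_pos (-(M.lam * τ))
  have h4 := div_pos M.c_pos M.lam_pos
  have h2 := mul_nonneg (sub_nonneg.2 h1) M.B_pos.le
  have h3 := mul_pos h0 h4
  linarith

theorem U_add_nonneg {τ : ℝ} (h : 0 ≤ τ) : 0 ≤ M.U τ + M.c * τ := by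
  have hl := M.lam_pos
  have h1 := M.exp_neg_lam_le h
  have h2 := mul_nonneg (sub_nonneg.2 h1) M.B_pos.le
  have h3 : 1 - Real.exp (-(M.lam * τ)) ≤ M.lam * τ := by
    linarith [Real.add_one_le_exp (-(M.lam * τ))]
  have h4 := mul_le_mul_of_nonneg_right h3 (div_pos M.c_pos hl).le
  rw [show M.lam * τ * (M.c / M.lam) = M.c * τ by field_simp] at h4
  rw [U, mul_sub]
  linarith

/-- Regrouped as `μ (U + c τ) + λ (B - U)`, the denominator is positive whatever the sign of `λ -
μ`. -/
theorem qDen_pos {τ : ℝ} (h : 0 ≤ τ) : 0 < M.qDen τ := by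
  have h1 := mul_nonneg M.mu_pos.le (M.U_add_nonneg h)
  have h2 := mul_pos M.lam_pos (M.B_sub_U_pos h)
  rw [qDen]
  linarith

theorem continuousOn_qHat : ContinuousOn M.qHat (Ici 0) := by
  have h1 := M.continuous_V
  have h2 := M.continuous_U
  refine ContinuousOn.div (by fun_prop) (by fun_prop) fun τ hτ => (M.qDen_pos hτ).ne'

theorem qHat_zero : M.qHat 0 = 0 := by simp [qHat, V_zero]

theorem continuousOn_q : ContinuousOn M.q (Ici 0) :=
  continuous_min.comp_continuousOn (continuousOn_const.prodMk M.continuousOn_qHat)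

/-- The gain from thinking first, `qNum - p * qDen`, grows in `τ` where it vanishes, as long as
`p` does not exceed the threshold. -/
theorem deriv_qNum_sub (p τ : ℝ) :
    M.mu * (M.nu * (M.B - M.c / M.nu - M.V τ) + M.c) -
        p * (M.mu * M.c - (M.lam - M.mu) * (M.lam * (M.B - M.U τ) - M.c)) =
      M.lam * p * (1 - p) * M.qDen τ +
        M.mu * (M.lam * (M.B + M.c / M.mu - M.V τ)) * (M.thresholdRHS τ - p) -
        M.lam * p * (M.qNum τ - p * M.qDen τ) := by
  have h := (mul_pos M.lam_pos (M.prize_gap_pos τ)).ne'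
  have hm := M.mu_pos.ne'
  rw [mul_assoc M.mu, mul_sub _ (M.thresholdRHS τ), thresholdRHS, (M.hasDerivAt_V τ).deriv,
    mul_div_cancel₀ _ h, qNum, qDen]
  have h5 : M.mu * (M.c / M.mu) = M.c := by field_simp
  linear_combination M.lam * p * h5

/-- A level `p < 1` lying below the threshold is crossed by `qHat` upwards only. -/
theorem qHat_gt_of_le {p s t : ℝ} (hp : 0 < p) (hp1 : p < 1) (hs : 0 ≤ s) (hst : s < t)
    (hR : p ≤ M.thresholdRHS t) (h : p ≤ M.qHat s) : p < M.qHat t := by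
  have key : ∀ u, 0 ≤ u → (p ≤ M.qHat u ↔ 0 ≤ M.qNum u - p * M.qDen u) := fun u hu => by
    rw [qHat_eq, le_div_iff₀ (M.qDen_pos hu), sub_nonneg]
  have hd : ∀ u, HasDerivAt (fun u => M.qNum u - p * M.qDen u) _ u := fun u =>
    (M.hasDerivAt_qNum u).sub ((M.hasDerivAt_qDen u).const_mul p)
  -- At a zero the last term of `deriv_qNum_sub` drops out, the threshold term is nonnegative and `λ
  -- p (1 - p) qDen` is positive.
  have hzero : ∀ u ∈ Icc s t, M.qNum u - p * M.qDen u = 0 →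
      0 < M.mu * (M.nu * (M.B - M.c / M.nu - M.V u) + M.c) -
        p * (M.mu * M.c - (M.lam - M.mu) * (M.lam * (M.B - M.U u) - M.c)) := by
    intro u hu h0
    rw [M.deriv_qNum_sub, h0]
    have h1 : p ≤ M.thresholdRHS u := hR.trans (M.strictAnti_thresholdRHS.antitone hu.2)
    have h2 := mul_pos (mul_pos (mul_pos M.lam_pos hp) (sub_pos.2 hp1)) (M.qDen_pos (hs.trans hu.1))
    have h3 := mul_nonneg (mul_pos M.mu_pos (mul_pos M.lam_pos (M.prize_gap_pos u))).le
      (sub_nonneg.2 h1)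
    linarith
  -- Barrier argument: the negated gain cannot rise above 0, because its derivative is negative
  -- wherever it equals 0.
  have hnonneg : ∀ u ∈ Icc s t, 0 ≤ M.qNum u - p * M.qDen u := by
    intro u hu
    have := image_le_of_liminf_slope_right_lt_deriv_boundary'
      (f := fun u => -(M.qNum u - p * M.qDen u)) (a := s) (b := t)
      (f' := fun u => -(M.mu * (M.nu * (M.B - M.c / M.nu - M.V u) + M.c) -
        p * (M.mu * M.c - (M.lam - M.mu) * (M.lam * (M.B - M.U u) - M.c))))
      (B := fun _ => 0) (B' := fun _ => 0)
      (fun u _ => (hd u).neg.continuousAt.continuousWithinAt)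
      (fun u _ r hr => (hd u).neg.hasDerivWithinAt.liminf_right_slope_le hr)
      (by simpa using (key s hs).1 h) continuousOn_const
      (fun u _ => hasDerivWithinAt_const _ _ _)
      (fun u hu h0 => by
        have := hzero u ⟨hu.1, hu.2.le⟩ (neg_eq_zero.1 h0)
        simpa using this) hu
    simpa using this
  -- Equality at `t` would, by the positive derivative there, make the gain negative just to the
  -- left of `t`.
  refine lt_of_le_of_ne ((key t (hs.trans hst.le)).2 (hnonneg t ⟨hst.le, le_rfl⟩)) fun heq => ?_
  have h0 : M.qNum t - p * M.qDen t = 0 := by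
    rw [heq, qHat_eq, div_mul_cancel₀ _ (M.qDen_pos (hs.trans hst.le)).ne', sub_self]
  have hpos := hzero t ⟨hst.le, le_rfl⟩ h0
  have hev : ∀ᶠ u in 𝓝[<] t, M.qNum u - p * M.qDen u < 0 := by
    have h1 : ∀ᶠ u in 𝓝[<] t, 0 < slope (fun u => M.qNum u - p * M.qDen u) t u := by
      have h2 := (hasDerivAt_iff_tendsto_slope.1 (hd t)).eventually (lt_mem_nhds hpos)
      exact h2.filter_mono (nhdsWithin_mono _ fun u hu => ne_of_lt hu)
    filter_upwards [h1, self_mem_nhdsWithin] with u hu hut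
    rw [slope_def_field, h0, sub_zero] at hu
    by_contra! hge
    exact absurd hu (not_lt.2 (div_nonpos_of_nonneg_of_nonpos hge (sub_neg.2 hut).le))
  obtain ⟨u, hu1, hu2⟩ := (hev.and (Ioo_mem_nhdsLT hst)).exists
  exact absurd (hnonneg u ⟨hu2.1.le, hu2.2.le⟩) (not_le.2 hu1)

/-- The numerator is at least `μ c τ`, the denominator `μ c τ` plus a bounded term. `K` bounds `p`
times the latter. -/
theorem eventually_lt_qHat {p : ℝ} (hp : 0 ≤ p) (hp1 : p < 1) : ∀ᶠ τ in atTop, p < M.qHat τ := by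
  have hk : 0 < (1 - p) * (M.mu * M.c) := mul_pos (sub_pos.2 hp1) (mul_pos M.mu_pos M.c_pos)
  set K := p * (M.mu * M.B + (M.lam + M.mu) * (M.B + M.c / M.lam))
  filter_upwards [eventually_ge_atTop 0, eventually_gt_atTop (K / ((1 - p) * (M.mu * M.c)))]
    with τ h0 hτ
  rw [qHat_eq, lt_div_iff₀ (M.qDen_pos h0), qNum, qDen]
  rw [div_lt_iff₀ hk] at hτ
  have h1 := mul_nonneg M.mu_pos.le (M.V_nonneg h0)
  have h2 := M.B_sub_U_pos h0
  have h3 := M.B_sub_U_le h0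
  have h4 : (M.lam - M.mu) * (M.B - M.U τ) ≤ (M.lam + M.mu) * (M.B + M.c / M.lam) := by
    have := mul_pos M.mu_pos h2
    have := mul_le_mul_of_nonneg_left h3 (add_pos M.lam_pos M.mu_pos).le
    linarith
  have h5 := mul_le_mul_of_nonneg_left h4 hp
  simp only [K] at hτ
  linarith

/-! ### Effort paths and cumulated efforts. -/

section Policies

variable {T : ℝ} {a : ℝ → ℝ}

theorem Admissible.intervalIntegrable (ha : Admissible T a) {s t : ℝ} (hs : s ∈ Icc 0 T)
    (ht : t ∈ Icc 0 T) : IntervalIntegrable a volume s t := by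
  rw [intervalIntegrable_iff]
  refine Measure.integrableOn_of_bounded (M := 1) (by simp [uIoc])
    ha.1.aestronglyMeasurable ?_
  refine (ae_restrict_iff' measurableSet_uIoc).2 (Eventually.of_forall fun x hx => ?_)
  have h := ha.2 x (ordConnected_Icc.uIcc_subset hs ht (uIoc_subset_uIcc hx))
  rw [Real.norm_eq_abs, abs_le]
  exact ⟨by linarith [h.1], h.2⟩

theorem pastDoing_self (T : ℝ) (a : ℝ → ℝ) : pastDoing T a T = 0 := by simp [pastDoing]

theorem Admissible.pastDoing_sub (ha : Admissible T a) {s t : ℝ} (hs : s ∈ Icc 0 T)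
    (ht : t ∈ Icc 0 T) : pastDoing T a s - pastDoing T a t = ∫ u in s..t, a u := by
  have hT : T ∈ Icc 0 T := ⟨hs.1.trans hs.2, le_rfl⟩
  rw [pastDoing, pastDoing, ← intervalIntegral.integral_add_adjacent_intervals
    (ha.intervalIntegrable hs ht) (ha.intervalIntegrable ht hT)]
  ring

theorem Admissible.pastDoing_sub_mem (ha : Admissible T a) {s t : ℝ} (hs : 0 ≤ s) (hst : s ≤ t)
    (ht : t ≤ T) : pastDoing T a s - pastDoing T a t ∈ Icc 0 (t - s) := by
  have hs' : s ∈ Icc 0 T := ⟨hs, hst.trans ht⟩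
  have ht' : t ∈ Icc 0 T := ⟨hs.trans hst, ht⟩
  rw [ha.pastDoing_sub hs' ht']
  constructor
  · exact intervalIntegral.integral_nonneg hst fun u hu =>
      (ha.2 u ⟨hs.trans hu.1, hu.2.trans ht⟩).1
  · have := intervalIntegral.integral_mono_on hst (ha.intervalIntegrable hs' ht')
      (intervalIntegrable_const (c := (1 : ℝ))) fun u hu =>
      (ha.2 u ⟨hs.trans hu.1, hu.2.trans ht⟩).2
    simpa using this

theorem Admissible.pastDoing_anti (ha : Admissible T a) {s t : ℝ} (hs : 0 ≤ s) (hst : s ≤ t)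
    (ht : t ≤ T) : pastDoing T a t ≤ pastDoing T a s :=
  sub_nonneg.1 (ha.pastDoing_sub_mem hs hst ht).1

theorem Admissible.pastDoing_nonneg (ha : Admissible T a) {s : ℝ} (hs : s ∈ Icc 0 T) :
    0 ≤ pastDoing T a s := by
  simpa [pastDoing_self] using ha.pastDoing_anti hs.1 hs.2 le_rfl

theorem Admissible.pastDoing_le (ha : Admissible T a) {s : ℝ} (hs : s ∈ Icc 0 T) :
    pastDoing T a s ≤ T - s := by
  simpa [pastDoing_self] using (ha.pastDoing_sub_mem hs.1 hs.2 le_rfl).2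

/-- Efforts are merely measurable; the Lipschitz bound gives the absolute continuity that the
fundamental theorem of calculus needs in `integral_flow`. -/
theorem Admissible.lipschitzOnWith_pastDoing (ha : Admissible T a) :
    LipschitzOnWith 1 (pastDoing T a) (Icc 0 T) := by
  refine LipschitzOnWith.of_dist_le_mul fun s hs t ht => ?_
  rw [Real.dist_eq, Real.dist_eq, NNReal.coe_one, one_mul]
  rcases le_total s t with h | h
  · have := ha.pastDoing_sub_mem hs.1 h ht.2
    rw [abs_of_nonneg this.1, abs_of_nonpos (by linarith)]
    linarith [this.2]
  · have := ha.pastDoing_sub_mem ht.1 h hs.2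
    rw [abs_sub_comm, abs_of_nonneg this.1, abs_of_nonneg (by linarith)]
    exact this.2

theorem Admissible.continuousOn_pastDoing (ha : Admissible T a) :
    ContinuousOn (pastDoing T a) (Icc 0 T) :=
  ha.lipschitzOnWith_pastDoing.continuousOn

theorem Admissible.ae_hasDerivAt_pastDoing (ha : Admissible T a) (hT : 0 ≤ T) :
    ∀ᵐ τ, τ ∈ Icc 0 T → HasDerivAt (pastDoing T a) (-a τ) τ := by
  filter_upwards [(ha.intervalIntegrable ⟨le_rfl, hT⟩ ⟨hT, le_rfl⟩).ae_hasDerivAt_integral]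
    with τ h hτ
  rw [uIcc_of_le hT] at h
  have h1 := (h hτ T ⟨hT, le_rfl⟩).neg
  refine h1.congr_of_eventuallyEq (Eventually.of_forall fun x => ?_)
  simp [pastDoing, intervalIntegral.integral_symm T x]

/-- Effort spent on the thinking arm when time `τ` remains. -/
def pastThinking (T : ℝ) (a : ℝ → ℝ) (τ : ℝ) : ℝ := T - τ - pastDoing T a τ

theorem pastThinking_self (T : ℝ) (a : ℝ → ℝ) : pastThinking T a T = 0 := by
  simp [pastThinking, pastDoing_self]

theorem Admissible.lipschitzOnWith_pastThinking (ha : Admissible T a) :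
    LipschitzOnWith 1 (pastThinking T a) (Icc 0 T) := by
  refine LipschitzOnWith.of_dist_le_mul fun s hs t ht => ?_
  rw [Real.dist_eq, Real.dist_eq, NNReal.coe_one, one_mul, pastThinking, pastThinking]
  rcases le_total s t with h | h
  · have := ha.pastDoing_sub_mem hs.1 h ht.2
    rw [abs_of_nonneg (by linarith [this.2]), abs_of_nonpos (by linarith)]
    linarith [this.1]
  · have := ha.pastDoing_sub_mem ht.1 h hs.2
    rw [abs_of_nonpos (by linarith [this.2]), abs_of_nonneg (by linarith)]
    linarith [this.1]

theorem Admissible.continuousOn_pastThinking (ha : Admissible T a) :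
    ContinuousOn (pastThinking T a) (Icc 0 T) :=
  ha.lipschitzOnWith_pastThinking.continuousOn

/-- A function of class `C¹` composed with a Lipschitz one is absolutely continuous. -/
theorem absolutelyContinuousOnInterval_comp {f φ : ℝ → ℝ} {K : NNReal} {s t : ℝ}
    (hf : ContDiff ℝ 1 f) (hφ : LipschitzOnWith K φ (uIcc s t)) :
    AbsolutelyContinuousOnInterval (fun τ => f (φ τ)) s t := by
  obtain ⟨R, hR⟩ := isCompact_uIcc.exists_bound_of_continuousOn hφ.continuousOn
  obtain ⟨C, hC⟩ := hf.contDiffOn.exists_lipschitzOnWith (by decide) (convex_closedBall (0 : ℝ) R)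
    (isCompact_closedBall _ _)
  have := hC.comp hφ (fun x hx => mem_closedBall_zero_iff.2 (hR x hx))
  exact this.absolutelyContinuousOnInterval

/-! ### Payoffs as functions on the effort plane. -/

/-- Unconditional probability of no solution after doing effort `x`. -/
def survival (p x : ℝ) : ℝ := 1 - p + p * Real.exp (-(M.lam * x))

/-- Expected payoff from doing effort `x`. -/
def doValue (p x : ℝ) : ℝ := p * M.U x - (1 - p) * M.c * x

/-- Marginal payoff of thinking effort after doing effort `x` and thinking effort `y`, net of
its effect on the weight of `doValue`. -/
def thinkGain (p T x y : ℝ) : ℝ :=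
  Real.exp (-(M.mu * y)) * (M.survival p x * (M.mu * M.V (T - x - y) - M.c) + M.mu * M.doValue p x)

/-- The integrand of `payoff`. -/
def flow (p T : ℝ) (a : ℝ → ℝ) (τ : ℝ) : ℝ :=
  Real.exp (-(M.mu * (T - τ - pastDoing T a τ))) *
    (1 - p + p * Real.exp (-(M.lam * pastDoing T a τ))) *
    (M.mu * (1 - a τ) * M.V τ + M.lam * a τ * M.belief p T a τ * M.B - M.c)

theorem survival_pos {p : ℝ} (hp : 0 < p) (hp1 : p < 1) (x : ℝ) : 0 < M.survival p x :=
  add_pos (sub_pos.2 hp1) (mul_pos hp (Real.exp_pos _))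

theorem survival_mul_posterior {p : ℝ} (hp : 0 < p) (hp1 : p < 1) (x : ℝ) :
    M.survival p x * M.posterior p x = p * Real.exp (-(M.lam * x)) := by
  rw [posterior, add_comm (p * _) (1 - p)]
  exact mul_div_cancel₀ _ (M.survival_pos hp hp1 x).ne'

theorem hasDerivAt_exp_neg_mul (k x : ℝ) :
    HasDerivAt (fun x => Real.exp (-(k * x))) (-(k * Real.exp (-(k * x)))) x := by
  have h1 : HasDerivAt (fun s : ℝ => -(k * s)) (-(k * 1)) x :=
    ((hasDerivAt_id x).const_mul k).neg
  exact h1.exp.congr_deriv (by ring)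

theorem hasDerivAt_survival (p x : ℝ) :
    HasDerivAt (M.survival p) (-(M.lam * (p * Real.exp (-(M.lam * x))))) x := by
  refine (((hasDerivAt_exp_neg_mul M.lam x).const_mul p).const_add (1 - p)).congr_deriv ?_
  ring

theorem hasDerivAt_doValue (p x : ℝ) :
    HasDerivAt (M.doValue p)
      (M.lam * (p * Real.exp (-(M.lam * x))) * M.B - M.c * M.survival p x) x := by
  refine (((M.hasDerivAt_U x).const_mul p).sub
    ((hasDerivAt_id x).const_mul ((1 - p) * M.c))).congr_deriv ?_
  have := M.lam_pos.ne'
  rw [U, survival]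
  field_simp
  ring

theorem doValue_zero (p : ℝ) : M.doValue p 0 = 0 := by simp [doValue, U_zero]

theorem contDiff_doValue (p : ℝ) : ContDiff ℝ 1 (M.doValue p) := by
  unfold doValue U
  fun_prop

theorem continuous_thinkGain (p T : ℝ) :
    Continuous fun z : ℝ × ℝ => M.thinkGain p T z.1 z.2 := by
  have h1 := M.continuous_V
  have h2 := (M.contDiff_doValue p).continuous
  unfold thinkGain survival
  fun_prop

/-- Thinking gains less after more doing exactly when the belief is below the threshold. -/
theorem hasDerivAt_thinkGain {p : ℝ} (hp : 0 < p) (hp1 : p < 1) (T x y : ℝ) :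
    HasDerivAt (fun x => M.thinkGain p T x y)
      (Real.exp (-(M.mu * y)) * (M.survival p x * (M.mu * (M.lam *
        (M.B + M.c / M.mu - M.V (T - x - y)))) *
          (M.posterior p x - M.thresholdRHS (T - x - y)))) x := by
  have hV : HasDerivAt (fun x => M.V (T - x - y))
      (M.nu * (M.B - M.c / M.nu - M.V (T - x - y)) * (-1)) x :=
    HasDerivAt.comp x (h₂ := M.V) (h := fun x => T - x - y) (M.hasDerivAt_V (T - x - y))
      (((hasDerivAt_id' x).const_sub T).sub_const y)
  have h := (((M.hasDerivAt_survival p x).mul ((hV.const_mul M.mu).sub_const M.c)).add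
    ((M.hasDerivAt_doValue p x).const_mul M.mu)).const_mul (Real.exp (-(M.mu * y)))
  refine h.congr_deriv ?_
  have h0 := (mul_pos M.lam_pos (M.prize_gap_pos (T - x - y))).ne'
  have h1 := M.survival_mul_posterior hp hp1 x
  have h5 : M.mu * (M.c / M.mu) = M.c := mul_div_cancel₀ _ M.mu_pos.ne'
  have h2 : M.lam * (M.B + M.c / M.mu - M.V (T - x - y)) * M.thresholdRHS (T - x - y)
      = M.nu * (M.B - M.c / M.nu - M.V (T - x - y)) + M.c := by
    rw [thresholdRHS, (M.hasDerivAt_V _).deriv, mul_div_cancel₀ _ h0]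
  congr 1
  linear_combination (-M.mu * M.lam * (M.B + M.c / M.mu - M.V (T - x - y))) * h1 +
    M.mu * M.survival p x * h2 - M.lam * p * Real.exp (-(M.lam * x)) * h5

end Policies

theorem strictAntiOn_thinkGain {p X : ℝ} (hp : 0 < p) (hp1 : p < 1) (T y : ℝ)
    (h : ∀ x ∈ Ioo 0 X, M.posterior p x < M.thresholdRHS (T - x - y)) :
    StrictAntiOn (fun x => M.thinkGain p T x y) (Icc 0 X) := by
  refine strictAntiOn_of_deriv_neg (convex_Icc _ _)
    (fun x _ => (M.hasDerivAt_thinkGain hp hp1 T x y).continuousAt.continuousWithinAt) fun x hx => ?_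
  rw [interior_Icc] at hx
  rw [(M.hasDerivAt_thinkGain hp hp1 T x y).deriv]
  refine mul_neg_of_pos_of_neg (Real.exp_pos _) (mul_neg_of_pos_of_neg (mul_pos
    (M.survival_pos hp hp1 x) (mul_pos M.mu_pos (mul_pos M.lam_pos (M.prize_gap_pos _)))) ?_)
  linarith [h x hx]

theorem strictMonoOn_thinkGain {p X : ℝ} (hp : 0 < p) (hp1 : p < 1) (T y : ℝ)
    (h : ∀ x ∈ Ioo 0 X, M.thresholdRHS (T - x - y) < M.posterior p x) :
    StrictMonoOn (fun x => M.thinkGain p T x y) (Icc 0 X) := by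
  refine strictMonoOn_of_deriv_pos (convex_Icc _ _)
    (fun x _ => (M.hasDerivAt_thinkGain hp hp1 T x y).continuousAt.continuousWithinAt) fun x hx => ?_
  rw [interior_Icc] at hx
  rw [(M.hasDerivAt_thinkGain hp hp1 T x y).deriv]
  refine mul_pos (Real.exp_pos _) (mul_pos (mul_pos
    (M.survival_pos hp hp1 x) (mul_pos M.mu_pos (mul_pos M.lam_pos (M.prize_gap_pos _)))) ?_)
  linarith [h x hx]

/-! ### Bayes' rule. -/

theorem posterior_zero (p : ℝ) : M.posterior p 0 = p := by simp [posterior]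


theorem posterior_eq (p x : ℝ) :
    M.posterior p x = p / (p + (1 - p) * Real.exp (M.lam * x)) := by
  have h := Real.exp_pos (M.lam * x)
  rw [posterior, Real.exp_neg, ← mul_div_mul_right _ _ h.ne', add_mul, mul_assoc p,
    inv_mul_cancel₀ h.ne', mul_one]

theorem posterior_denom_pos {p : ℝ} (hp : 0 < p) (hp1 : p < 1) (x : ℝ) :
    0 < p + (1 - p) * Real.exp (M.lam * x) :=
  add_pos hp (mul_pos (sub_pos.2 hp1) (Real.exp_pos _))

theorem strictAnti_posterior {p : ℝ} (hp : 0 < p) (hp1 : p < 1) : StrictAnti (M.posterior p) := by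
  intro x y hxy
  rw [M.posterior_eq p, M.posterior_eq p]
  refine div_lt_div_of_pos_left hp (M.posterior_denom_pos hp hp1 x) ?_
  have := mul_lt_mul_of_pos_left (Real.exp_lt_exp.2 (mul_lt_mul_of_pos_left hxy M.lam_pos))
    (sub_pos.2 hp1)
  linarith

theorem continuous_posterior {p : ℝ} (hp : 0 < p) (hp1 : p < 1) : Continuous (M.posterior p) := by
  have h : M.posterior p = fun x => p / (p + (1 - p) * Real.exp (M.lam * x)) :=
    funext (M.posterior_eq p)
  have h1 := fun x => (M.posterior_denom_pos hp hp1 x).ne'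
  rw [h]
  fun_prop (disch := exact h1 _)

theorem posterior_pos {p : ℝ} (hp : 0 < p) (hp1 : p < 1) (x : ℝ) : 0 < M.posterior p x := by
  rw [M.posterior_eq p]
  exact div_pos hp (M.posterior_denom_pos hp hp1 x)

theorem posterior_lt_one {p : ℝ} (hp : 0 < p) (hp1 : p < 1) (x : ℝ) : M.posterior p x < 1 := by
  rw [M.posterior_eq p, div_lt_one (M.posterior_denom_pos hp hp1 x)]
  linarith [mul_pos (sub_pos.2 hp1) (Real.exp_pos (M.lam * x))]

/-- Beliefs are ordered like likelihood ratios. -/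
theorem posterior_le_posterior_iff {p r : ℝ} (hp : 0 < p) (hp1 : p < 1) (hr : 0 < r) (hr1 : r < 1)
    (x y : ℝ) :
    M.posterior p x ≤ M.posterior r y ↔
      y + 1 / M.lam * Real.log (p * (1 - r) / (r * (1 - p))) ≤ x := by
  have hl := M.lam_pos
  have hp1' := sub_pos.2 hp1
  have hr1' := sub_pos.2 hr1
  have h1 : 0 < p * (1 - r) / (r * (1 - p)) := by positivity
  have h2 : y + 1 / M.lam * Real.log (p * (1 - r) / (r * (1 - p))) ≤ x ↔
      Real.log (p * (1 - r) / (r * (1 - p))) ≤ M.lam * x - M.lam * y := by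
    rw [← mul_le_mul_iff_of_pos_left hl, mul_add, ← mul_assoc, mul_one_div_cancel hl.ne', one_mul,
      le_sub_iff_add_le']
  rw [h2, Real.log_le_iff_le_exp h1, Real.exp_sub, div_le_div_iff₀ (mul_pos hr hp1')
    (Real.exp_pos _), M.posterior_eq p, M.posterior_eq r,
    div_le_div_iff₀ (M.posterior_denom_pos hp hp1 x) (M.posterior_denom_pos hr hr1 y)]
  constructor <;> intro h <;> linarith

/-- With `posterior_add`, this makes the continuation after effort `x` the same problem started from
the updated belief. -/
theorem survival_add {p : ℝ} (hp : 0 < p) (hp1 : p < 1) (x y : ℝ) :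
    M.survival p (x + y) = M.survival p x * M.survival (M.posterior p x) y := by
  have h := M.survival_mul_posterior hp hp1 x
  rw [survival] at h
  rw [survival, survival, survival, mul_add M.lam, neg_add, Real.exp_add]
  linear_combination (1 - Real.exp (-(M.lam * y))) * h

theorem posterior_add {p : ℝ} (hp : 0 < p) (hp1 : p < 1) (x y : ℝ) :
    M.posterior p (x + y) = M.posterior (M.posterior p x) y := by
  have hq := M.posterior_pos hp hp1 x
  have hq1 := M.posterior_lt_one hp hp1 x
  have h1 := M.survival_mul_posterior hp hp1 (x + y)
  have h2 := M.survival_mul_posterior hp hp1 x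
  have h3 := M.survival_mul_posterior hq hq1 y
  refine mul_left_cancel₀ (M.survival_pos hp hp1 (x + y)).ne' ?_
  rw [h1, M.survival_add hp hp1, mul_assoc, h3, ← mul_assoc, h2, mul_add, neg_add, Real.exp_add]
  ring

variable {p T : ℝ} {a : ℝ → ℝ}

/-! ### Green's formula for the payoff. -/

theorem payoff_eq (p T : ℝ) (a : ℝ → ℝ) : M.payoff p T a = ∫ τ in (0 : ℝ)..T, M.flow p T a τ := rfl

theorem sub_pastDoing_sub_pastThinking (T : ℝ) (a : ℝ → ℝ) (τ : ℝ) :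
    T - pastDoing T a τ - pastThinking T a τ = τ := by
  rw [pastThinking]; ring

theorem flow_eq (hp : 0 < p) (hp1 : p < 1) (T : ℝ) (a : ℝ → ℝ) (τ : ℝ) :
    M.flow p T a τ = Real.exp (-(M.mu * pastThinking T a τ)) *
      (M.survival p (pastDoing T a τ) * (M.mu * (1 - a τ) * M.V τ - M.c) +
        M.lam * a τ * M.B * (p * Real.exp (-(M.lam * pastDoing T a τ)))) := by
  rw [← M.survival_mul_posterior hp hp1, flow, belief, survival, pastThinking]
  ring

theorem Admissible.intervalIntegrable_thinking_mul (ha : Admissible T a) {f : ℝ → ℝ} {s t : ℝ}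
    (hs : s ∈ Icc 0 T) (ht : t ∈ Icc 0 T) (hf : ContinuousOn f (Icc 0 T)) :
    IntervalIntegrable (fun τ => (1 - a τ) * f τ) volume s t :=
  (intervalIntegrable_const.sub (ha.intervalIntegrable hs ht)).mul_continuousOn
    (hf.mono (ordConnected_Icc.uIcc_subset hs ht))

/-- Green's formula for the payoff collected while at least `s` time remains: the payoff of
thinking first and doing afterwards plus the line integral of the gain from delaying thought. -/
theorem integral_flow (hp : 0 < p) (hp1 : p < 1) (ha : Admissible T a) {s : ℝ} (hs : s ∈ Icc 0 T)
    {h : ℝ → ℝ} (hh : Continuous h) :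
    ∫ τ in s..T, M.flow p T a τ =
      Real.exp (-(M.mu * pastThinking T a s)) * M.doValue p (pastDoing T a s) +
        (∫ y in (0 : ℝ)..pastThinking T a s, h y) +
        ∫ τ in s..T, (1 - a τ) *
          (M.thinkGain p T (pastDoing T a τ) (pastThinking T a τ) - h (pastThinking T a τ)) := by
  have hT : T ∈ Icc 0 T := ⟨hs.1.trans hs.2, le_rfl⟩
  have hsub : uIcc s T ⊆ Icc 0 T := ordConnected_Icc.uIcc_subset hs hT
  set H : ℝ → ℝ := fun y => ∫ u in (0 : ℝ)..y, h u
  have hH : ∀ y, HasDerivAt H (h y) y := fun y => (hh.integral_hasStrictDerivAt 0 y).hasDerivAt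
  have hH1 : ContDiff ℝ 1 H := by
    rw [contDiff_one_iff_deriv]
    refine ⟨fun y => (hH y).differentiableAt, ?_⟩
    rwa [show deriv H = h from funext fun y => (hH y).deriv]
  -- For `h = thinkGain p T 0` this is the payoff of the efforts made so far when thinking precedes
  -- doing. The function `h` is left free so that `thinkGain p T x` can serve as reference for doing
  -- first.
  set E : ℝ → ℝ := fun τ => Real.exp (-(M.mu * pastThinking T a τ)) *
    M.doValue p (pastDoing T a τ) + H (pastThinking T a τ)
  have hAl := ha.lipschitzOnWith_pastDoing.mono hsub
  have hYl := ha.lipschitzOnWith_pastThinking.mono hsub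
  have hE : AbsolutelyContinuousOnInterval E s T := by
    refine AbsolutelyContinuousOnInterval.fun_add (AbsolutelyContinuousOnInterval.fun_mul
      (absolutelyContinuousOnInterval_comp (f := fun y => Real.exp (-(M.mu * y)))
        (by fun_prop) hYl)
      (absolutelyContinuousOnInterval_comp (M.contDiff_doValue p) hAl))
      (absolutelyContinuousOnInterval_comp hH1 hYl)
  have hET : E T = 0 := by simp [E, H, pastThinking_self, pastDoing_self, doValue_zero]
  have hFTC := hE.integral_deriv_eq_sub
  rw [hET, zero_sub] at hFTC
  have hk : IntervalIntegrable (fun τ => (1 - a τ) *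
      (M.thinkGain p T (pastDoing T a τ) (pastThinking T a τ) - h (pastThinking T a τ)))
      volume s T := by
    refine ha.intervalIntegrable_thinking_mul hs hT (ContinuousOn.sub ?_ ?_)
    · exact (M.continuous_thinkGain p T).comp_continuousOn
        (ha.continuousOn_pastDoing.prodMk ha.continuousOn_pastThinking)
    · exact hh.comp_continuousOn ha.continuousOn_pastThinking
  have key : ∫ τ in s..T, M.flow p T a τ = ∫ τ in s..T, (-deriv E τ + (1 - a τ) *
      (M.thinkGain p T (pastDoing T a τ) (pastThinking T a τ) - h (pastThinking T a τ))) := by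
    refine intervalIntegral.integral_congr_ae ?_
    filter_upwards [ha.ae_hasDerivAt_pastDoing hT.1] with τ hτ hmem
    have hA := hτ (hsub (uIoc_subset_uIcc hmem))
    have hY : HasDerivAt (pastThinking T a) (-1 - -a τ) τ :=
      ((hasDerivAt_id' τ).const_sub T).sub hA
    have h1 := HasDerivAt.comp τ (h₂ := fun y => Real.exp (-(M.mu * y)))
      (hasDerivAt_exp_neg_mul M.mu _) hY
    have h2 := HasDerivAt.comp τ (M.hasDerivAt_doValue p _) hA
    have h3 := HasDerivAt.comp τ (hH _) hY
    have hEd : HasDerivAt E _ τ := (h1.mul h2).add h3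
    rw [hEd.deriv, M.flow_eq hp hp1, thinkGain, sub_pastDoing_sub_pastThinking]
    simp only [Function.comp_apply]
    ring
  rw [key, intervalIntegral.integral_add (f := fun τ => -deriv E τ)
      hE.intervalIntegrable_deriv.neg hk,
    intervalIntegral.integral_neg, hFTC]
  simp only [E, H, neg_neg]

/-! ### Think-then-do policies and their first-order condition. -/

/-- Payoff of thinking until `s` time remains and doing afterwards. -/
def thinkThenDoPayoff (p T s : ℝ) : ℝ :=
  Real.exp (-(M.mu * (T - s))) * M.doValue p s + ∫ y in (0 : ℝ)..(T - s), M.thinkGain p T 0 y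

/-- Policies that think exactly while more than `s` time remains. -/
def SwitchesAt (T : ℝ) (a : ℝ → ℝ) (s : ℝ) : Prop :=
  (∀ᵐ τ, τ ∈ Ioc s T → a τ = 0) ∧ (∀ᵐ τ, τ ∈ Ico 0 s → a τ = 1)

theorem SwitchesAt.pastDoing_of_ge {s τ : ℝ} (h : SwitchesAt T a s) (h1 : s ≤ τ) (h2 : τ ≤ T) :
    pastDoing T a τ = 0 := by
  refine intervalIntegral.integral_zero_ae ?_
  filter_upwards [h.1] with u hu hmem
  rw [uIoc_of_le h2] at hmem
  exact hu ⟨h1.trans_lt hmem.1, hmem.2⟩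

theorem SwitchesAt.pastDoing_zero {s : ℝ} (h : SwitchesAt T a s) (ha : Admissible T a)
    (hs : s ∈ Icc 0 T) : pastDoing T a 0 = s := by
  have h1 := ha.pastDoing_sub ⟨le_rfl, hs.1.trans hs.2⟩ hs
  rw [h.pastDoing_of_ge le_rfl hs.2, sub_zero] at h1
  rw [h1]
  have h2 : ∫ u in (0 : ℝ)..s, a u = ∫ u in (0 : ℝ)..s, (1 : ℝ) := by
    refine intervalIntegral.integral_congr_ae ?_
    filter_upwards [h.2, Measure.ae_ne volume s] with u hu hne hmem
    rw [uIoc_of_le hs.1] at hmem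
    exact hu ⟨hmem.1.le, lt_of_le_of_ne hmem.2 hne⟩
  rw [h2]; simp

/-- The correction integral in Green's formula vanishes: there is no past doing while more than `s`
remains, and no thinking afterwards. -/
theorem SwitchesAt.payoff_eq {s : ℝ} (h : SwitchesAt T a s) (hp : 0 < p) (hp1 : p < 1)
    (ha : Admissible T a) (hs : s ∈ Icc 0 T) : M.payoff p T a = M.thinkThenDoPayoff p T s := by
  have hT := hs.1.trans hs.2
  have hc : Continuous fun y => M.thinkGain p T 0 y :=
    (M.continuous_thinkGain p T).comp (by fun_prop : Continuous fun y : ℝ => ((0 : ℝ), y))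
  rw [DoThink.payoff_eq, M.integral_flow hp hp1 ha ⟨le_rfl, hT⟩ hc, pastThinking,
    h.pastDoing_zero ha hs, sub_zero, thinkThenDoPayoff]
  refine add_eq_left.2 ?_
  refine intervalIntegral.integral_zero_ae ?_
  filter_upwards [h.2] with u hu hmem
  rw [uIoc_of_le hT] at hmem
  rcases lt_or_ge u s with hus | hus
  · rw [hu ⟨hmem.1.le, hus⟩]; simp
  · rw [h.pastDoing_of_ge hus hmem.2]; simp

/-- The policy that thinks until `s` time remains and does afterwards. -/
def thinkThenDo (s : ℝ) : ℝ → ℝ := (Iio s).indicator fun _ => 1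

theorem admissible_thinkThenDo (T s : ℝ) : Admissible T (thinkThenDo s) := by
  refine ⟨measurable_const.indicator measurableSet_Iio, fun τ _ => ?_⟩
  by_cases h : τ < s <;> simp [thinkThenDo, h]

theorem switchesAt_thinkThenDo (T s : ℝ) : SwitchesAt T (thinkThenDo s) s := by
  refine ⟨Eventually.of_forall fun τ h => ?_, Eventually.of_forall fun τ h => ?_⟩
  · simp [thinkThenDo, h.1.le]
  · simp [thinkThenDo, h.2]

theorem IsOptimal.thinkThenDoPayoff_le (h : M.IsOptimal p T a) (hp : 0 < p) (hp1 : p < 1) {s : ℝ}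
    (hs : s ∈ Icc 0 T) : M.thinkThenDoPayoff p T s ≤ M.payoff p T a := by
  rw [← (switchesAt_thinkThenDo T s).payoff_eq M hp hp1 (admissible_thinkThenDo T s) hs]
  exact h.2 _ (admissible_thinkThenDo T s)

theorem hasDerivAt_thinkThenDoPayoff (p T s : ℝ) :
    HasDerivAt (M.thinkThenDoPayoff p T)
      (Real.exp (-(M.mu * (T - s))) * (p * M.qDen s - M.qNum s)) s := by
  have hc : Continuous fun y => M.thinkGain p T 0 y :=
    (M.continuous_thinkGain p T).comp (by fun_prop : Continuous fun y : ℝ => ((0 : ℝ), y))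
  have h0 : HasDerivAt (fun s : ℝ => T - s) (-1) s := (hasDerivAt_id' s).const_sub T
  have h1 := HasDerivAt.comp s (h₂ := fun y => Real.exp (-(M.mu * y)))
    (hasDerivAt_exp_neg_mul M.mu _) h0
  have h3 := HasDerivAt.comp s (h₂ := fun y => ∫ u in (0 : ℝ)..y, M.thinkGain p T 0 u)
    (hc.integral_hasStrictDerivAt 0 (T - s)).hasDerivAt h0
  refine ((h1.mul (M.hasDerivAt_doValue p s)).add h3).congr_deriv ?_
  simp only [Function.comp_apply, thinkGain, doValue_zero, sub_zero, sub_sub_cancel]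
  rw [qDen, qNum, survival, survival, doValue, B_sub_U, U]
  have := M.lam_pos.ne'
  simp only [mul_zero, neg_zero, Real.exp_zero]
  field_simp
  ring

/-- Doing no longer before the deadline does not pay. -/
theorem IsOptimal.le_qHat_of_switchesAt (h : M.IsOptimal p T a) (hp : 0 < p) (hp1 : p < 1) {s : ℝ}
    (hs : 0 ≤ s) (hsT : s < T) (hsw : SwitchesAt T a s) : p ≤ M.qHat s := by
  rw [qHat_eq, le_div_iff₀ (M.qDen_pos hs)]
  by_contra! hlt
  have hd := M.hasDerivAt_thinkThenDoPayoff p T s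
  have hpos := mul_pos (Real.exp_pos (-(M.mu * (T - s)))) (sub_pos.2 hlt)
  have h1 : ∀ᶠ u in 𝓝[>] s, 0 < slope (M.thinkThenDoPayoff p T) s u :=
    ((hasDerivAt_iff_tendsto_slope.1 hd).eventually (lt_mem_nhds hpos)).filter_mono
      (nhdsWithin_mono _ fun u hu => ne_of_gt hu)
  obtain ⟨u, hu1, hu2⟩ := (h1.and (Ioo_mem_nhdsGT hsT)).exists
  have h2 := h.thinkThenDoPayoff_le M hp hp1 (s := u) ⟨hs.trans hu2.1.le, hu2.2.le⟩
  rw [hsw.payoff_eq M hp hp1 h.1 ⟨hs, hsT.le⟩] at h2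
  rw [slope_def_field] at hu1
  exact absurd hu1 (not_lt.2 (div_nonpos_of_nonpos_of_nonneg (sub_nonpos.2 h2)
    (sub_pos.2 hu2.1).le))

/-- Thinking a little longer before doing does not pay. -/
theorem IsOptimal.qHat_le_of_switchesAt (h : M.IsOptimal p T a) (hp : 0 < p) (hp1 : p < 1) {s : ℝ}
    (hs : 0 < s) (hsT : s ≤ T) (hsw : SwitchesAt T a s) : M.qHat s ≤ p := by
  rw [qHat_eq, div_le_iff₀ (M.qDen_pos hs.le)]
  by_contra! hlt
  have hd := M.hasDerivAt_thinkThenDoPayoff p T s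
  have hneg := mul_neg_of_pos_of_neg (Real.exp_pos (-(M.mu * (T - s)))) (sub_neg.2 hlt)
  have h1 : ∀ᶠ u in 𝓝[<] s, slope (M.thinkThenDoPayoff p T) s u < 0 :=
    ((hasDerivAt_iff_tendsto_slope.1 hd).eventually (gt_mem_nhds hneg)).filter_mono
      (nhdsWithin_mono _ fun u hu => ne_of_lt hu)
  obtain ⟨u, hu1, hu2⟩ := (h1.and (Ioo_mem_nhdsLT hs)).exists
  have h2 := h.thinkThenDoPayoff_le M hp hp1 (s := u) ⟨hu2.1.le, hu2.2.le.trans hsT⟩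
  rw [hsw.payoff_eq M hp hp1 h.1 ⟨hs.le, hsT⟩] at h2
  rw [slope_def_field] at hu1
  exact absurd hu1 (not_lt.2 (div_nonneg_of_nonpos (sub_nonpos.2 h2) (sub_neg.2 hu2.2).le))

/-! ### The order of efforts below and above the threshold curve. -/

theorem intervalIntegrable_flow (hp : 0 < p) (hp1 : p < 1) (ha : Admissible T a) {s t : ℝ}
    (hs : s ∈ Icc 0 T) (ht : t ∈ Icc 0 T) : IntervalIntegrable (M.flow p T a) volume s t := by
  have hA := ha.continuousOn_pastDoing
  have hY := ha.continuousOn_pastThinking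
  have hV := M.continuous_V
  have h1 : ContinuousOn (fun τ => Real.exp (-(M.mu * pastThinking T a τ)) *
      (M.survival p (pastDoing T a τ) * (M.mu * M.V τ) -
        M.lam * M.B * (p * Real.exp (-(M.lam * pastDoing T a τ))))) (Icc 0 T) := by
    unfold survival
    fun_prop
  have h2 : ContinuousOn (fun τ => Real.exp (-(M.mu * pastThinking T a τ)) *
      (M.lam * M.B * (p * Real.exp (-(M.lam * pastDoing T a τ))) -
        M.survival p (pastDoing T a τ) * M.c)) (Icc 0 T) := by
    unfold survival
    fun_prop
  refine ((ha.intervalIntegrable_thinking_mul hs ht h1).add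
    (h2.mono (ordConnected_Icc.uIcc_subset hs ht)).intervalIntegrable).congr fun τ _ => ?_
  simp only [M.flow_eq hp hp1]
  ring

/-- Turns the failure of a reordering to improve the payoff into pointwise information on the
effort. -/
theorem ae_eq_zero_of_nonpos_of_integral_nonneg {f : ℝ → ℝ} {s t : ℝ} (hst : s ≤ t)
    (hf : IntervalIntegrable f volume s t) (hle : ∀ τ ∈ Icc s t, f τ ≤ 0)
    (h : 0 ≤ ∫ τ in s..t, f τ) : ∀ᵐ τ, τ ∈ Ioc s t → f τ = 0 := by
  have hneg : 0 ≤ᵐ[volume.restrict (Ioc s t)] fun τ => -f τ :=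
    (ae_restrict_iff' measurableSet_Ioc).2 (Eventually.of_forall fun τ hτ =>
      neg_nonneg.2 (hle τ (Ioc_subset_Icc_self hτ)))
  have h0 : ∫ τ in s..t, -f τ = 0 := by
    refine le_antisymm ?_ (intervalIntegral.integral_nonneg_of_ae_restrict hst ?_)
    · rw [intervalIntegral.integral_neg]; linarith
    · exact (ae_restrict_iff' measurableSet_Icc).2 (Eventually.of_forall fun τ hτ =>
        neg_nonneg.2 (hle τ hτ))
  have h1 := (intervalIntegral.integral_eq_zero_iff_of_le_of_nonneg_ae hst hneg hf.neg).1 h0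
  filter_upwards [(ae_restrict_iff' measurableSet_Ioc).1 h1] with τ hτ hmem
  simpa using hτ hmem

/-- The time at which doing starts. -/
theorem Admissible.exists_start (ha : Admissible T a) (hT : 0 ≤ T) :
    ∃ r ∈ Icc 0 T, (∀ᵐ τ, τ ∈ Ioc r T → a τ = 0) ∧ (∀ τ ∈ Ico 0 r, 0 < pastDoing T a τ) ∧
      pastDoing T a r = 0 := by
  have hcl : IsClosed (Icc 0 T ∩ pastDoing T a ⁻¹' {0}) :=
    ha.continuousOn_pastDoing.preimage_isClosed_of_isClosed isClosed_Icc isClosed_singleton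
  have hne : (Icc 0 T ∩ pastDoing T a ⁻¹' {0}).Nonempty :=
    ⟨T, ⟨hT, le_rfl⟩, pastDoing_self T a⟩
  have hbdd : BddBelow (Icc 0 T ∩ pastDoing T a ⁻¹' {0}) := ⟨0, fun x hx => hx.1.1⟩
  obtain ⟨hr, hr0⟩ := hcl.csInf_mem hne hbdd
  refine ⟨_, hr, ?_, fun τ hτ => ?_, hr0⟩
  · have h1 := ae_eq_zero_of_nonpos_of_integral_nonneg (f := fun τ => -a τ) hr.2
      (ha.intervalIntegrable hr ⟨hT, le_rfl⟩).neg
      (fun τ hτ => neg_nonpos.2 (ha.2 τ ⟨hr.1.trans hτ.1, hτ.2⟩).1)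
      (by rw [intervalIntegral.integral_neg]; exact (neg_eq_zero.2 hr0).ge)
    filter_upwards [h1] with τ h hτ
    simpa using h hτ
  · have hτ' : τ ∈ Icc 0 T := ⟨hτ.1, hτ.2.le.trans hr.2⟩
    refine lt_of_le_of_ne (ha.pastDoing_nonneg hτ') fun h0 => ?_
    exact absurd (csInf_le hbdd ⟨hτ', h0.symm⟩) (not_le.2 hτ.2)

theorem Admissible.pastThinking_nonneg (ha : Admissible T a) {s : ℝ} (hs : s ∈ Icc 0 T) :
    0 ≤ pastThinking T a s :=
  sub_nonneg.2 (ha.pastDoing_le hs)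

theorem Admissible.pastThinking_anti (ha : Admissible T a) {s t : ℝ} (hs : 0 ≤ s) (hst : s ≤ t)
    (ht : t ≤ T) : pastThinking T a t ≤ pastThinking T a s := by
  have := (ha.pastDoing_sub_mem hs hst ht).2
  rw [pastThinking, pastThinking]
  linarith

theorem Admissible.continuousOn_thinkGain_sub (ha : Admissible T a) (p x : ℝ) :
    ContinuousOn (fun τ => M.thinkGain p T (pastDoing T a τ) (pastThinking T a τ) -
      M.thinkGain p T x (pastThinking T a τ)) (Icc 0 T) := by
  refine ContinuousOn.sub ?_ ?_
  · exact (M.continuous_thinkGain p T).comp_continuousOn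
      (ha.continuousOn_pastDoing.prodMk ha.continuousOn_pastThinking)
  · exact (M.continuous_thinkGain p T).comp_continuousOn
      (continuousOn_const.prodMk ha.continuousOn_pastThinking)

theorem continuous_thinkGain_right (p T x : ℝ) : Continuous fun y => M.thinkGain p T x y :=
  (M.continuous_thinkGain p T).comp (by fun_prop : Continuous fun y : ℝ => (x, y))

/-- From a belief below the threshold on, an optimal policy thinks first and does afterwards. -/
theorem IsOptimal.exists_switchesAt (h : M.IsOptimal p T a) (hp : 0 < p) (hp1 : p < 1) (hT : 0 ≤ T)
    (hR : p ≤ M.thresholdRHS T) : ∃ s ∈ Icc 0 T, SwitchesAt T a s := by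
  have ha := h.1
  have h0 : (0 : ℝ) ∈ Icc 0 T := ⟨le_rfl, hT⟩
  -- Doing lowers the belief below `p`, while the curve at the time remaining is no lower than at
  -- `T`; so `thinkGain` strictly decreases in `x`.
  have hlt : ∀ τ ∈ Icc 0 T, 0 < pastDoing T a τ →
      M.thinkGain p T (pastDoing T a τ) (pastThinking T a τ) -
        M.thinkGain p T 0 (pastThinking T a τ) < 0 := by
    intro τ hτ hpos
    have hanti := M.strictAntiOn_thinkGain (X := pastDoing T a τ) hp hp1 T (pastThinking T a τ)
      fun x hx => by
        have h1 := M.strictAnti_posterior hp hp1 hx.1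
        rw [posterior_zero] at h1
        refine h1.trans_le (hR.trans (M.strictAnti_thresholdRHS.antitone ?_))
        linarith [hx.1, ha.pastThinking_nonneg hτ]
    exact sub_neg.2 (hanti ⟨le_rfl, hpos.le⟩ ⟨hpos.le, le_rfl⟩ hpos)
  have hle : ∀ τ ∈ Icc 0 T, (1 - a τ) *
      (M.thinkGain p T (pastDoing T a τ) (pastThinking T a τ) -
        M.thinkGain p T 0 (pastThinking T a τ)) ≤ 0 := by
    intro τ hτ
    refine mul_nonpos_of_nonneg_of_nonpos (sub_nonneg.2 (ha.2 τ hτ).2) ?_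
    rcases (ha.pastDoing_nonneg hτ).eq_or_lt with h1 | h1
    · rw [← h1, sub_self]
    · exact (hlt τ hτ h1).le
  -- The competitor makes the same total efforts, with all thinking first.
  have hint := h.thinkThenDoPayoff_le M hp hp1 (s := pastDoing T a 0)
    ⟨ha.pastDoing_nonneg h0, by simpa using ha.pastDoing_le h0⟩
  rw [payoff_eq, M.integral_flow hp hp1 ha h0 (M.continuous_thinkGain_right p T 0), pastThinking,
    sub_zero, thinkThenDoPayoff, le_add_iff_nonneg_right] at hint
  have hae := ae_eq_zero_of_nonpos_of_integral_nonneg hT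
    (ha.intervalIntegrable_thinking_mul h0 ⟨hT, le_rfl⟩ (ha.continuousOn_thinkGain_sub M p 0))
    hle hint
  obtain ⟨r, hr, hzero, hpos, -⟩ := ha.exists_start hT
  refine ⟨r, hr, hzero, ?_⟩
  filter_upwards [hae, Measure.ae_ne volume 0] with τ hτ hne hmem
  have hτT : τ < T := hmem.2.trans_le hr.2
  have h1 := hτ ⟨lt_of_le_of_ne hmem.1 hne.symm, hτT.le⟩
  rcases mul_eq_zero.1 h1 with h2 | h2
  · linarith
  · exact absurd h2 (hlt τ ⟨hmem.1, hτT.le⟩ (hpos τ hmem)).ne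

/-- As long as the belief stays above the threshold, an optimal policy that does at all does
first. -/
theorem IsOptimal.beginsWithDoing (h : M.IsOptimal p T a) (hp : 0 < p) (hp1 : p < 1) {s : ℝ}
    (hs : s ∈ Icc 0 T) (hpos : 0 < pastDoing T a s)
    (hR : M.thresholdRHS s ≤ M.belief p T a s) : BeginsWithDoing T a := by
  have ha := h.1
  have hT := hs.1.trans hs.2
  have h0 : (0 : ℝ) ∈ Icc 0 T := ⟨le_rfl, hT⟩
  have hTm : T ∈ Icc 0 T := ⟨hT, le_rfl⟩
  set x := pastDoing T a s with hx
  set y := pastThinking T a s with hy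
  have hy0 : 0 ≤ y := ha.pastThinking_nonneg hs
  have hxy : T - x = s + y := by rw [hy, pastThinking]; ring
  have hlt : ∀ τ ∈ Icc s T, pastDoing T a τ < x →
      M.thinkGain p T (pastDoing T a τ) (pastThinking T a τ) -
        M.thinkGain p T x (pastThinking T a τ) < 0 := by
    intro τ hτ hτx
    have hτ' : τ ∈ Icc 0 T := ⟨hs.1.trans hτ.1, hτ.2⟩
    -- For `z < x` the belief exceeds that at `s`, and more than `s` time remains at `(z,
    -- pastThinking T a τ)`, so the curve there is lower than at `s`.
    have hmono := M.strictMonoOn_thinkGain (X := x) hp hp1 T (pastThinking T a τ)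
      fun z hz => by
        refine (M.strictAnti_thresholdRHS ?_).trans
          (hR.trans_lt (M.strictAnti_posterior hp hp1 hz.2))
        linarith [hz.2, ha.pastThinking_anti hs.1 hτ.1 hτ.2]
    exact sub_neg.2 (hmono ⟨ha.pastDoing_nonneg hτ', hτx.le⟩ ⟨hpos.le, le_rfl⟩ hτx)
  have hle : ∀ τ ∈ Icc s T, (1 - a τ) *
      (M.thinkGain p T (pastDoing T a τ) (pastThinking T a τ) -
        M.thinkGain p T x (pastThinking T a τ)) ≤ 0 := by
    intro τ hτ
    refine mul_nonpos_of_nonneg_of_nonpos (sub_nonneg.2 (ha.2 τ ⟨hs.1.trans hτ.1, hτ.2⟩).2) ?_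
    rcases (ha.pastDoing_anti hs.1 hτ.1 hτ.2).eq_or_lt with h1 | h1
    · rw [h1, sub_self]
    · exact (hlt τ hτ h1).le
  -- The competitor first does `x`, then thinks `y`, and follows `a` from `s` on.
  set b : ℝ → ℝ := (Iic s).piecewise a ((Ioi (s + y)).indicator fun _ => 1) with hb
  have hbs : ∀ τ, τ ≤ s → b τ = a τ := fun τ hτ => piecewise_eq_of_mem _ _ _ hτ
  have hb0 : ∀ τ, s < τ → τ ≤ s + y → b τ = 0 := fun τ h1 h2 => by
    rw [hb, piecewise_eq_of_notMem _ _ _ (notMem_Iic.2 h1)]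
    exact indicator_of_notMem (not_lt.2 h2) _
  have hb1 : ∀ τ, s + y < τ → b τ = 1 := fun τ h1 => by
    rw [hb, piecewise_eq_of_notMem _ _ _ (notMem_Iic.2 (by linarith : s < τ))]
    exact indicator_of_mem h1 _
  have hbadm : Admissible T b := by
    refine ⟨ha.1.piecewise measurableSet_Iic (measurable_const.indicator measurableSet_Ioi),
      fun τ hτ => ?_⟩
    rcases le_or_gt τ s with h1 | h1
    · rw [hbs τ h1]; exact ha.2 τ hτ
    · rcases le_or_gt τ (s + y) with h2 | h2
      · rw [hb0 τ h1 h2]; simp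
      · rw [hb1 τ h2]; simp
  have hsy : s + y ∈ Icc 0 T := ⟨by linarith [hs.1], by linarith⟩
  have hAsy : pastDoing T b (s + y) = x := by
    rw [pastDoing, intervalIntegral.integral_congr_ae (g := fun _ => (1 : ℝ))
      (Eventually.of_forall fun u hu => hb1 u (by rw [uIoc_of_le hsy.2] at hu; exact hu.1))]
    simp only [intervalIntegral.integral_const, smul_eq_mul, mul_one]
    linarith
  have hAmid : ∀ τ ∈ Icc s (s + y), pastDoing T b τ = x := by
    intro τ hτ
    have h1 := hbadm.pastDoing_sub ⟨hs.1.trans hτ.1, hτ.2.trans hsy.2⟩ hsy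
    rw [intervalIntegral.integral_zero_ae (Eventually.of_forall fun u hu => by
      rw [uIoc_of_le hτ.2] at hu; exact hb0 u (hτ.1.trans_lt hu.1) hu.2), hAsy] at h1
    linarith
  have hAs := hAmid s ⟨le_rfl, by linarith⟩
  have hYs : pastThinking T b s = y := by rw [hy, pastThinking, pastThinking, hAs]
  have hAlow : ∀ τ ∈ Icc 0 s, pastDoing T b τ = pastDoing T a τ := by
    intro τ hτ
    have hτ' : τ ∈ Icc 0 T := ⟨hτ.1, hτ.2.trans hs.2⟩
    have h1 := hbadm.pastDoing_sub hτ' hs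
    rw [intervalIntegral.integral_congr_ae (g := a) (Eventually.of_forall fun u hu => by
      rw [uIoc_of_le hτ.2] at hu; exact hbs u hu.2), ← ha.pastDoing_sub hτ' hs, hAs] at h1
    linarith
  have hlow : ∫ τ in (0 : ℝ)..s, M.flow p T b τ = ∫ τ in (0 : ℝ)..s, M.flow p T a τ := by
    refine intervalIntegral.integral_congr fun τ hτ => ?_
    rw [uIcc_of_le hs.1] at hτ
    simp only [flow, belief, hAlow τ hτ, hbs τ hτ.2]
  have hc := M.continuous_thinkGain_right p T x
  have hhigh : ∫ τ in s..T, (1 - b τ) *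
      (M.thinkGain p T (pastDoing T b τ) (pastThinking T b τ) -
        M.thinkGain p T x (pastThinking T b τ)) = 0 := by
    refine intervalIntegral.integral_zero_ae (Eventually.of_forall fun τ hτ => ?_)
    rw [uIoc_of_le hs.2] at hτ
    rcases le_or_gt τ (s + y) with h2 | h2
    · rw [hAmid τ ⟨hτ.1.le, h2⟩]; simp
    · rw [hb1 τ h2]; simp
  have hopt := h.2 b hbadm
  rw [payoff_eq, payoff_eq,
    ← intervalIntegral.integral_add_adjacent_intervals
      (M.intervalIntegrable_flow hp hp1 hbadm h0 hs) (M.intervalIntegrable_flow hp hp1 hbadm hs hTm),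
    ← intervalIntegral.integral_add_adjacent_intervals
      (M.intervalIntegrable_flow hp hp1 ha h0 hs) (M.intervalIntegrable_flow hp hp1 ha hs hTm),
    hlow, add_le_add_iff_left, M.integral_flow hp hp1 hbadm hs hc, hhigh, add_zero,
    M.integral_flow hp hp1 ha hs hc, hAs, hYs, ← hx, ← hy, le_add_iff_nonneg_right] at hopt
  have hae := ae_eq_zero_of_nonpos_of_integral_nonneg hs.2
    (ha.intervalIntegrable_thinking_mul hs hTm (ha.continuousOn_thinkGain_sub M p x)) hle hopt
  have hxT : x ≤ T - s := ha.pastDoing_le hs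
  -- Within the first `x / 2` units of time less than `x` has been done, so the strict inequality
  -- `hlt` applies and thinking is excluded almost everywhere.
  refine ⟨x / 2, half_pos hpos, by linarith [hs.1], ?_⟩
  filter_upwards [hae] with τ hτ hmem
  have hsτ : s < τ := by linarith [hmem.1]
  have hlt' := hlt τ ⟨hsτ.le, hmem.2⟩
    ((ha.pastDoing_le ⟨hs.1.trans hsτ.le, hmem.2⟩).trans_lt (by linarith [hmem.1]))
  rcases mul_eq_zero.1 (hτ ⟨hsτ, hmem.2⟩) with h2 | h2
  · linarith
  · exact absurd h2 hlt'.ne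

/-! ### Continuation problems and the principle of optimality. -/

theorem Admissible.mono (ha : Admissible T a) {t : ℝ} (ht : t ≤ T) : Admissible t a :=
  ⟨ha.1, fun τ hτ => ha.2 τ ⟨hτ.1, hτ.2.trans ht⟩⟩

theorem Admissible.pastDoing_eq_add (ha : Admissible T a) {s t : ℝ} (hs : 0 ≤ s) (hst : s ≤ t)
    (ht : t ≤ T) : pastDoing T a s = pastDoing T a t + pastDoing t a s := by
  have := ha.pastDoing_sub ⟨hs, hst.trans ht⟩ ⟨hs.trans hst, ht⟩
  rw [show pastDoing t a s = ∫ u in s..t, a u from rfl]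
  linarith

theorem Admissible.belief_eq (ha : Admissible T a) (hp : 0 < p) (hp1 : p < 1) {s t : ℝ}
    (hs : 0 ≤ s) (hst : s ≤ t) (ht : t ≤ T) :
    M.belief p T a s = M.belief (M.belief p T a t) t a s := by
  rw [belief, ha.pastDoing_eq_add hs hst ht, M.posterior_add hp hp1]
  rfl

theorem flow_eq_mul_flow (hp : 0 < p) (hp1 : p < 1) (ha : Admissible T a) {s t : ℝ} (hs : 0 ≤ s)
    (hst : s ≤ t) (ht : t ≤ T) :
    M.flow p T a s = Real.exp (-(M.mu * pastThinking T a t)) * M.survival p (pastDoing T a t) *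
      M.flow (M.belief p T a t) t a s := by
  have h1 := ha.pastDoing_eq_add hs hst ht
  have h2 : -(M.mu * (T - s - pastDoing T a s)) =
      -(M.mu * pastThinking T a t) + -(M.mu * (t - s - pastDoing t a s)) := by
    rw [h1, pastThinking]; ring
  have h3 := M.survival_add hp hp1 (pastDoing T a t) (pastDoing t a s)
  rw [flow, flow, h2, Real.exp_add, ha.belief_eq M hp hp1 hs hst ht, h1]
  rw [survival.eq_1 M p (_ + _), survival.eq_1 M (M.posterior _ _)] at h3
  rw [h3]
  simp only [belief]
  ring

theorem Admissible.payoff_eq_add (ha : Admissible T a) (hp : 0 < p) (hp1 : p < 1) {t : ℝ}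
    (ht : t ∈ Icc 0 T) :
    M.payoff p T a = Real.exp (-(M.mu * pastThinking T a t)) * M.survival p (pastDoing T a t) *
      M.payoff (M.belief p T a t) t a + ∫ τ in t..T, M.flow p T a τ := by
  have hT := ht.1.trans ht.2
  rw [payoff_eq, payoff_eq, ← intervalIntegral.integral_add_adjacent_intervals
    (M.intervalIntegrable_flow hp hp1 ha ⟨le_rfl, hT⟩ ht)
    (M.intervalIntegrable_flow hp hp1 ha ht ⟨hT, le_rfl⟩), add_left_inj,
    ← intervalIntegral.integral_const_mul]
  refine intervalIntegral.integral_congr fun τ hτ => ?_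
  rw [uIcc_of_le ht.1] at hτ
  exact M.flow_eq_mul_flow hp hp1 ha hτ.1 hτ.2 ht.2

theorem pastDoing_congr {b : ℝ → ℝ} {s : ℝ} (hs : s ≤ T) (h : ∀ u ∈ Ioc s T, a u = b u) :
    pastDoing T a s = pastDoing T b s :=
  intervalIntegral.integral_congr_ae (Eventually.of_forall fun u hu => by
    rw [uIoc_of_le hs] at hu; exact h u hu)

theorem flow_congr {b : ℝ → ℝ} {s : ℝ} (hs : s ≤ T) (h : ∀ u ∈ Ioc s T, a u = b u)
    (h0 : a s = b s) : M.flow p T a s = M.flow p T b s := by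
  simp only [flow, belief, pastDoing_congr hs h, h0]

/-- The principle of optimality. -/
theorem IsOptimal.tail (h : M.IsOptimal p T a) (hp : 0 < p) (hp1 : p < 1) {t : ℝ}
    (ht : t ∈ Icc 0 T) : M.IsOptimal (M.belief p T a t) t a := by
  refine ⟨h.1.mono ht.2, fun b hb => ?_⟩
  set d : ℝ → ℝ := (Iic t).piecewise b a with hd
  have hdb : ∀ τ, τ ≤ t → d τ = b τ := fun τ hτ => piecewise_eq_of_mem _ _ _ hτ
  have hda : ∀ τ, t < τ → d τ = a τ := fun τ hτ => piecewise_eq_of_notMem _ _ _ (notMem_Iic.2 hτ)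
  have hdadm : Admissible T d := by
    refine ⟨hb.1.piecewise measurableSet_Iic h.1.1, fun τ hτ => ?_⟩
    rcases le_or_gt τ t with h1 | h1
    · rw [hdb τ h1]; exact hb.2 τ ⟨hτ.1, h1⟩
    · rw [hda τ h1]; exact h.1.2 τ hτ
  have hA : pastDoing T d t = pastDoing T a t := pastDoing_congr ht.2 fun u hu => hda u hu.1
  have hY : pastThinking T d t = pastThinking T a t := by rw [pastThinking, pastThinking, hA]
  have hbel : M.belief p T d t = M.belief p T a t := by rw [belief, belief, hA]
  have htail : ∀ r, M.payoff r t d = M.payoff r t b := fun r => by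
    rw [payoff_eq, payoff_eq]
    refine intervalIntegral.integral_congr fun τ hτ => ?_
    rw [uIcc_of_le ht.1] at hτ
    exact M.flow_congr hτ.2 (fun u hu => hdb u hu.2) (hdb τ hτ.2)
  have hhead : ∫ τ in t..T, M.flow p T d τ = ∫ τ in t..T, M.flow p T a τ :=
    intervalIntegral.integral_congr_ae (Eventually.of_forall fun τ hτ => by
      rw [uIoc_of_le ht.2] at hτ
      exact M.flow_congr hτ.2 (fun u hu => hda u (hτ.1.trans hu.1)) (hda τ hτ.1))
  have hopt := h.2 d hdadm
  rw [hdadm.payoff_eq_add M hp hp1 ht, h.1.payoff_eq_add M hp hp1 ht, hA, hY, hbel, htail, hhead,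
    add_le_add_iff_right] at hopt
  exact le_of_mul_le_mul_left hopt (mul_pos (Real.exp_pos _) (M.survival_pos hp hp1 _))

/-! ### The thresholds and the bounds on optimal behaviour. -/

theorem exists_q_eq_thresholdRHS (h : M.pHat < 1) : ∃ τ, 0 ≤ τ ∧ M.q τ = M.thresholdRHS τ := by
  -- For large times `q` is above the level `m` and the curve, which tends to `pHat`, below it; at
  -- time 0 the order is reversed.
  obtain ⟨m, hm, hm1⟩ := exists_between h
  obtain ⟨N, hN0, hNq, hNR⟩ := ((eventually_ge_atTop 0).and ((M.eventually_lt_qHat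
    (M.pHat_pos.trans hm).le hm1).and (M.tendsto_thresholdRHS.eventually (gt_mem_nhds hm)))).exists
  have hc : ContinuousOn (fun τ => M.q τ - M.thresholdRHS τ) (Icc 0 N) :=
    (M.continuousOn_q.mono Icc_subset_Ici_self).sub M.continuous_thresholdRHS.continuousOn
  have h0 : M.q 0 - M.thresholdRHS 0 ≤ 0 := by
    have := M.thresholdRHS_pos 0
    rw [q, qHat_zero, min_eq_right zero_le_one]
    linarith
  have h1 : 0 ≤ M.q N - M.thresholdRHS N := by
    have := lt_min hm1 hNq
    rw [q]
    linarith
  obtain ⟨τ, hτ, h2⟩ := intermediate_value_Icc hN0 hc ⟨h0, h1⟩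
  exact ⟨τ, hτ.1, sub_eq_zero.1 h2⟩

theorem q_eq_iff (hp1 : p < 1) (τ : ℝ) : M.q τ = p ↔ M.qHat τ = p := by
  rw [q]
  constructor <;> intro h
  · rcases min_choice 1 (M.qHat τ) with h1 | h1 <;> linarith
  · rw [h, min_eq_right hp1.le]

theorem exists_qHat_eq_pHat (h : M.pHat < 1) : ∃ τ, 0 ≤ τ ∧ M.qHat τ = M.pHat := by
  obtain ⟨N, hN0, hNq⟩ := ((eventually_ge_atTop 0).and
    (M.eventually_lt_qHat M.pHat_pos.le h)).exists
  obtain ⟨τ, hτ, h2⟩ := intermediate_value_Icc hN0 (M.continuousOn_qHat.mono Icc_subset_Ici_self)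
    ⟨M.qHat_zero.trans_le M.pHat_pos.le, hNq.le⟩
  exact ⟨τ, hτ.1, h2⟩

/-- The level `pHat` lies below the whole threshold curve, so `qHat` can cross it only once. -/
theorem qPreimage_pHat (h : M.pHat < 1) {τ : ℝ} (hτ : 0 ≤ τ) (hq : M.qHat τ = M.pHat) :
    M.qPreimage M.pHat = {τ} := by
  ext s
  simp only [qPreimage, mem_ofPred_eq, M.q_eq_iff h, mem_singleton_iff]
  refine ⟨fun hs => ?_, fun hs => hs ▸ ⟨hτ, hq⟩⟩
  rcases lt_trichotomy s τ with h1 | h1 | h1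
  · have := M.qHat_gt_of_le M.pHat_pos h hs.1 h1 (M.pHat_lt_thresholdRHS τ).le hs.2.ge
    linarith
  · exact h1
  · have := M.qHat_gt_of_le M.pHat_pos h hτ h1 (M.pHat_lt_thresholdRHS s).le hq.ge
    linarith [hs.2]

theorem IsOptimal.beginsWithDoing_of_lt {τ : ℝ} (hq : M.q τ = M.thresholdRHS τ)
    (hp : 0 < p) (hp1 : p < 1) (hlt : M.q τ < p) (hT : 0 < T) (h : M.IsOptimal p T a) :
    BeginsWithDoing T a := by
  have ha := h.1
  have hqHat : M.qHat τ = M.thresholdRHS τ := (M.q_eq_iff (hq ▸ hlt.trans hp1) τ).1 hq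
  have hlt' : M.thresholdRHS τ < p := hq ▸ hlt
  obtain ⟨r, hr, hzero, hpos, hr0⟩ := ha.exists_start hT.le
  have hbel : M.belief p T a r = p := by rw [belief, hr0, posterior_zero]
  -- When doing starts, with `r` left, the belief is still `p`. If `p` is at or below the curve at
  -- `r`, the agent does from then on; `r < T` would give `p ≤ qHat r` with `r < τ`, and the upward
  -- crossing rules out `qHat τ = thresholdRHS τ`.
  rcases le_or_gt p (M.thresholdRHS r) with hR | hR
  · have hsw : SwitchesAt T a r := by
      have htail := h.tail M hp hp1 hr
      rw [hbel] at htail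
      obtain ⟨s, hs, hsw⟩ := htail.exists_switchesAt M hp hp1 hr.1 hR
      have hsr : s = r := by
        refine le_antisymm hs.2 (not_lt.1 fun hlt => ?_)
        have h1 := ha.pastDoing_eq_add hs.1 hs.2 hr.2
        rw [hr0, hsw.pastDoing_of_ge le_rfl hs.2, zero_add] at h1
        exact absurd h1 (hpos s ⟨hs.1, hlt⟩).ne'
      exact ⟨hzero, hsr ▸ hsw.2⟩
    rcases hr.2.eq_or_lt with hrT | hrT
    · refine ⟨T, hT, le_rfl, ?_⟩
      filter_upwards [hsw.2, Measure.ae_ne volume T] with u hu hne hmem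
      exact hu ⟨by linarith [hmem.1], hrT ▸ lt_of_le_of_ne hmem.2 hne⟩
    · have h1 := h.le_qHat_of_switchesAt M hp hp1 hr.1 hrT hsw
      have h2 : r < τ := M.strictAnti_thresholdRHS.lt_iff_gt.1 (hlt'.trans_le hR)
      have h3 := M.qHat_gt_of_le (M.thresholdRHS_pos τ) (hlt'.trans hp1) hr.1 h2 le_rfl
        (hlt'.le.trans h1)
      exact absurd hqHat h3.ne'
  · rcases hr.1.eq_or_lt with hr00 | hr00
    · have hsw : SwitchesAt T a 0 :=
        ⟨hr00 ▸ hzero, Eventually.of_forall fun u hu => absurd hu.2 (not_lt.2 hu.1)⟩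
      have h1 := h.le_qHat_of_switchesAt M hp hp1 le_rfl hT hsw
      rw [qHat_zero] at h1
      exact absurd hp (not_lt.2 h1)
    -- By continuity the belief is still above the curve shortly after doing has started, where past
    -- doing is already positive.
    · have hc : ContinuousWithinAt (fun τ => M.belief p T a τ - M.thresholdRHS τ) (Icc 0 T) r :=
        (((M.continuous_posterior hp hp1).comp_continuousOn ha.continuousOn_pastDoing).sub
          M.continuous_thresholdRHS.continuousOn) r hr
      have hev := (hc.mono (Ioo_subset_Icc_self.trans (Icc_subset_Icc_right hr.2))
        : ContinuousWithinAt _ (Ioo 0 r) r).eventually (lt_mem_nhds (by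
          simpa [hbel] using hR : 0 < M.belief p T a r - M.thresholdRHS r))
      rw [nhdsWithin_Ioo_eq_nhdsLT hr00] at hev
      obtain ⟨s, hs, hmem⟩ := (hev.and (Ioo_mem_nhdsLT hr00)).exists
      exact h.beginsWithDoing M hp hp1 ⟨hmem.1.le, hmem.2.le.trans hr.2⟩
        (hpos s ⟨hmem.1.le, hmem.2⟩) (sub_pos.1 hs).le

theorem IsOptimal.posterior_pHat_le_belief (h1 : M.pHat < 1) {t : ℝ} (ht : 0 ≤ t)
    (hq : M.qHat t = M.pHat) (hp : 0 < p) (hp1 : p < 1) (hle : M.pHat ≤ p) (hT : 0 ≤ T)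
    (h : M.IsOptimal p T a) {τ : ℝ} (hτ : τ ∈ Icc 0 T) :
    M.posterior M.pHat t ≤ M.belief p T a τ := by
  have ha := h.1
  have h0T : (0 : ℝ) ∈ Icc 0 T := ⟨le_rfl, hT⟩
  suffices hfin : M.posterior M.pHat t ≤ M.belief p T a 0 from
    hfin.trans ((M.strictAnti_posterior hp hp1).antitone (ha.pastDoing_anti le_rfl hτ.1 hτ.2))
  by_contra! hlt
  have hlt' : M.belief p T a 0 < M.pHat := by
    refine hlt.trans_le ?_
    have := (M.strictAnti_posterior M.pHat_pos h1).antitone ht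
    rwa [posterior_zero] at this
  have hcont : ContinuousOn (M.belief p T a) (Icc 0 T) :=
    (M.continuous_posterior hp hp1).comp_continuousOn ha.continuousOn_pastDoing
  have hTp : M.belief p T a T = p := by rw [belief, pastDoing_self, posterior_zero]
  have hcl : IsClosed (Icc 0 T ∩ M.belief p T a ⁻¹' {M.pHat}) :=
    hcont.preimage_isClosed_of_isClosed isClosed_Icc isClosed_singleton
  have hne : (Icc 0 T ∩ M.belief p T a ⁻¹' {M.pHat}).Nonempty := by
    obtain ⟨u, hu, hup⟩ := intermediate_value_Icc hT hcont ⟨hlt'.le, hle.trans_eq hTp.symm⟩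
    exact ⟨u, hu, hup⟩
  have hbdd : BddBelow (Icc 0 T ∩ M.belief p T a ⁻¹' {M.pHat}) := ⟨0, fun x hx => hx.1.1⟩
  -- The infimum is the least remaining time, hence the last moment, at which the belief equals
  -- `pHat`.
  obtain ⟨hr, hbel⟩ := hcl.csInf_mem hne hbdd
  have hmin : ∀ u ∈ Icc 0 T, M.belief p T a u = M.pHat → _ ≤ u := fun u hu hup =>
    csInf_le hbdd ⟨hu, hup⟩
  generalize sInf (Icc 0 T ∩ M.belief p T a ⁻¹' {M.pHat}) = r at hr hbel hmin
  have hbel' : M.belief p T a r = M.pHat := hbel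
  have htail := h.tail M hp hp1 hr
  rw [hbel'] at htail
  obtain ⟨s, hs, hsw⟩ := htail.exists_switchesAt M M.pHat_pos h1 hr.1
    (M.pHat_lt_thresholdRHS r).le
  -- Thinking first at `r` would leave the belief at `pHat` until the later moment `s`, against the
  -- choice of `r`.
  have hsr : s = r := by
    refine le_antisymm hs.2 (hmin s ⟨hs.1, hs.2.trans hr.2⟩ ?_)
    rw [belief, ha.pastDoing_eq_add hs.1 hs.2 hr.2, hsw.pastDoing_of_ge le_rfl hs.2, add_zero]
    exact hbel'
  subst hsr
  have hspos : 0 < s := lt_of_le_of_ne hr.1 fun h0 => by rw [← h0] at hbel'; exact hlt'.ne hbel'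
  have h2 := htail.qHat_le_of_switchesAt M M.pHat_pos h1 hspos le_rfl hsw
  have hst : s ≤ t := by
    refine not_lt.1 fun hts => ?_
    exact absurd (M.qHat_gt_of_le M.pHat_pos h1 ht hts (M.pHat_lt_thresholdRHS s).le hq.ge)
      (not_lt.2 h2)
  have h3 : M.belief p T a 0 = M.posterior M.pHat s := by
    rw [ha.belief_eq M hp hp1 le_rfl hr.1 hr.2, hbel', belief,
      hsw.pastDoing_zero (ha.mono hr.2) ⟨hr.1, le_rfl⟩]
  rw [h3] at hlt
  exact absurd ((M.strictAnti_posterior M.pHat_pos h1).antitone hst) (not_le.2 hlt)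

end DoThink

end

theorem proposition7 (M : DoThink) (hreg : M.Regular) :
    -- (1) the threshold above which the agent begins by doing, whatever the deadline
    (M.pHat < 1 → ∃ ptilde τtilde : ℝ, τtilde ∈ M.qPreimage ptilde ∧
      ptilde = M.thresholdRHS τtilde ∧
      ∀ pbar, 0 < pbar → pbar < 1 → M.lam * pbar ≤ M.nu → ptilde < pbar →
        ∀ T, 0 < T → ∀ a, M.IsOptimal pbar T a → DoThink.BeginsWithDoing T a) ∧
    -- (2) below `p̂`: at most one switch, from thinking to doing
    (∀ pbar, 0 < pbar → pbar < 1 → M.lam * pbar ≤ M.nu → pbar < M.pHat →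
      ∀ T, 0 < T → ∀ a, M.IsOptimal pbar T a → DoThink.AtMostThinkThenDo T a) ∧
    -- (3) from `p̂` on: the lower bound on the belief
    (M.pHat < 1 → ∃ τhat : ℝ, M.qPreimage M.pHat = {τhat} ∧
      ∀ pbar, 0 < pbar → pbar < 1 → M.lam * pbar ≤ M.nu → M.pHat ≤ pbar →
        ∀ T, 0 < T →
          (∀ a, M.IsOptimal pbar T a →
            ∀ τ ∈ Icc 0 T, M.posterior M.pHat τhat ≤ M.belief pbar T a τ) ∧
          (M.posterior pbar T ≤ M.posterior M.pHat τhat ↔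
            τhat + 1 / M.lam * Real.log (pbar * (1 - M.pHat) / (M.pHat * (1 - pbar))) ≤ T)) := by
  refine ⟨fun h1 => ?_, fun p hp hp1 _ hlt T hT a h => ?_, fun h1 => ?_⟩
  · obtain ⟨τ, hτ, hq⟩ := M.exists_q_eq_thresholdRHS h1
    exact ⟨M.q τ, τ, ⟨hτ, rfl⟩, hq, fun p hp hp1 _ hlt T hT a h =>
      h.beginsWithDoing_of_lt M hq hp hp1 hlt hT⟩
  · exact h.exists_switchesAt M hp hp1 hT.le (hlt.trans (M.pHat_lt_thresholdRHS T)).le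
  · obtain ⟨t, ht, hq⟩ := M.exists_qHat_eq_pHat h1
    exact ⟨t, M.qPreimage_pHat h1 ht hq, fun p hp hp1 _ hle T hT =>
      ⟨fun a h τ hτ => h.posterior_pHat_le_belief M h1 ht hq hp hp1 hle hT.le hτ,
        M.posterior_le_posterior_iff hp hp1 M.pHat_pos h1 T t⟩⟩
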